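/- **Integral forms on $\mathbb P^{1|1}$.** Let $\mathbb P^{1|1}$ be the complex supermanifold over $\mathbb P^1=U_0\cup U_1$ glued from two copies of $\mathbb C^{1|1}$ with coordinates $z_{10}|\theta_{10}$ over $U_0$ and $z_{01}|\theta_{11}$ over $U_1$ by $z_{10}=1/z_{01}$, $\theta_{10}=\theta_{11}/z_{01}$, with structure sheaf $\mathcal O$. Let $\Pi\mathcal T$ be its parity-shifted tangent sheaf, with local frame $\pi\partial_\theta\,|\,\pi\partial_z$, and let $\mathcal Ber=\mathcal Ber(\Pi\mathcal T^*)^*$ be its Berezinian sheaf, with even local generator $\mathcal D[dz|d\theta]$. In the delta-function formalism, integral forms of degree $k$ over a chart are the $\mathcal O$-linear combinations of the symbols $dz^a\,\delta^{(r)}(d\theta)$ with $a\in\{0,1\}$, $r\ge 0$, $a-r=k$. Here $dz$ and $\delta^{(r)}(d\theta)$ are odd and $d\theta$ is even, $dz\,dz=0$, $d\theta\,\delta^{(0)}(d\theta)=0$ and $d\theta\,\delta^{(r)}(d\theta)=-r\,\delta^{(r-1)}(d\theta)$. The differential of a function is $df=dz\,\partial_zf+d\theta\,\partial_\theta f$,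 and a symbol is rewritten in the other chart by expressing $dz_{10}$ and $d\theta_{10}$ through $dz_{01}$ and $d\theta_{11}$ and applying, for $u$ even and invertible and $v$ odd, the rule $$\delta^{(r)}(u\,d\theta+v\,dz)=u^{-(r+1)}\big(\delta^{(r)}(d\theta)+u^{-1}v\,dz\,\delta^{(r+1)}(d\theta)\big).$$ Let $k\le 1$ and $n=1-k$. Then the following hold. 1. The delta-function integral forms of degree $k$ glue to a locally free sheaf $\Omega^{k;1}$ of $\mathcal O$-modules, of rank $1|1$ for $k<1$ and $1|0$ for $k=1$. With $z=z_{01}$, $\theta=\theta_{11}$, its transition matrix on $U_0\cap U_1$, in the frame $dz\,\delta^{(1-k)}(d\theta)\,|\,\delta^{(-k)}(d\theta)$ (rows: the frame over $U_0$ in terms of the frame over $U_1$), is $$\begin{pmatrix}-z^{-k}&0\\ \theta z^{-k}&z^{1-k}\end{pmatrix}\ (k<1),\qquad (-1/z)\ (k=1).$$ The sheaf $\mathcal Ber\otimes Sym^{1-k}\Pi\mathcal T$ has the same transition matrix in the frame $\mathcal D\otimes\pi\partial_\theta^{\odot 1-k}\,|\,\mathcal D\otimes\pi\partial_z\odot\pi\partial_\theta^{\odot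 -k}$. 2. Consequently there is an even isomorphism of sheaves of $\mathcal O$-modules $\Omega^{k;1}\cong\mathcal Ber\otimes Sym^{1-k}\Pi\mathcal T$, given in both charts by $dz\,\delta^{(1-k)}(d\theta)\mapsto\mathcal D[dz|d\theta]\otimes\pi\partial_\theta^{\odot 1-k}$ and, for $k<1$, $\delta^{(-k)}(d\theta)\mapsto\mathcal D[dz|d\theta]\otimes\pi\partial_z\odot\pi\partial_\theta^{\odot -k}$. 3. For $k\le 0$ there is a $\mathbb C$-linear morphism of sheaves $d^k:\mathcal Ber\otimes Sym^{1-k}\Pi\mathcal T\to\mathcal Ber\otimes Sym^{-k}\Pi\mathcal T$ given in both charts, for all superfunctions $F$ and all homogeneous superfunctions $G$, by $$d\big(\mathcal D\otimes(F\,\pi\partial_\theta^{\odot 1-k}+G\,\pi\partial_z\odot\pi\partial_\theta^{\odot -k})\big)=\mathcal D\otimes\big((-(1-k)\,\partial_\theta F+(-1)^{|G|}\partial_zG)\,\pi\partial_\theta^{\odot -k}-|k|\,\partial_\theta G\;\pi\partial_z\odot\pi\partial_\theta^{\odot -k-1}\big),$$ where the last term is absent for $k=0$. Under the isomorphism in 2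 it corresponds to $d(f\,dz^a\delta^{(r)}(d\theta))=df\,dz^a\delta^{(r)}(d\theta)$. Moreover $d^{k+1}\circ d^k=0$ for $k\le -1$, and $\mathcal Ber\otimes Sym^0\,\Pi\mathcal T\cong\mathcal Ber$, so that these sheaves form a complex $$\cdots\to\mathcal Ber\otimes Sym^{2}\Pi\mathcal T\to\mathcal Ber\otimes\Pi\mathcal T\to\mathcal Ber\to 0 .$$ -/

import Mathlib

open TopologicalSpace
open scoped TensorProduct

noncomputable section

namespace SuperP1

/-! ### Superfunctions on open subsets of the superspace `ℂ^{1|1}` -/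

/-- The algebra of holomorphic functions on an open subset `W` of `ℂ`. -/
def Hol (W : Opens ℂ) : Subalgebra ℂ (W → ℂ) where
  carrier := {f | ∃ g : ℂ → ℂ, DifferentiableOn ℂ g W ∧ ∀ x : W, f x = g x}
  mul_mem' := by
    rintro _ _ ⟨g, hg, h⟩ ⟨g', hg', h'⟩
    exact ⟨g * g', hg.mul hg', fun x => by simp [h, h']⟩
  add_mem' := by
    rintro _ _ ⟨g, hg, h⟩ ⟨g', hg', h'⟩
    exact ⟨g + g', hg.add hg', fun x => by simp [h, h']⟩
  algebraMap_mem' := fun c => ⟨fun _ => c, differentiableOn_const c, fun _ => rfl⟩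

/-- Substitution of a holomorphic map `u : W' → W` into holomorphic functions. -/
def Hol.comp {W W' : Opens ℂ} (u : ℂ → ℂ) (hu : DifferentiableOn ℂ u W')
    (hm : ∀ w ∈ W', u w ∈ W) : Hol W →ₐ[ℂ] Hol W' where
  toFun f := ⟨fun w => f.1 ⟨u w, hm w w.2⟩, by
    obtain ⟨g, hg, h⟩ := f.2
    exact ⟨g ∘ u, hg.comp hu (fun w hw => hm w hw), fun w => h ⟨u w, hm w w.2⟩⟩⟩
  map_one' := rfl
  map_mul' _ _ := rfl
  map_zero' := rfl
  map_add' _ _ := rfl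
  commutes' _ := rfl

/-- The complex derivative of a holomorphic function on `W`. -/
def Hol.deriv {W : Opens ℂ} (f : Hol W) : Hol W :=
  ⟨fun x => _root_.deriv (Function.extend Subtype.val f.1 0) x, by
    obtain ⟨g, hg, h⟩ := f.2
    refine ⟨_root_.deriv g, hg.deriv W.isOpen, fun x => ?_⟩
    apply Filter.EventuallyEq.deriv_eq
    filter_upwards [W.isOpen.mem_nhds x.2] with y hy
    have := Subtype.val_injective.extend_apply f.1 0 (⟨y, hy⟩ : W)
    exact this.trans (h ⟨y, hy⟩)⟩

/-- Superfunctions `f(z) + g(z) θ` on the open subsuperspace of `ℂ^{1|1}` over `W`; the dual-number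
generator is the odd coordinate `θ`. With a single odd coordinate this superalgebra is
commutative also in the ungraded sense. -/
def SFun (W : Opens ℂ) : Type := DualNumber (Hol W)

instance (W : Opens ℂ) : CommRing (SFun W) := inferInstanceAs (CommRing (DualNumber (Hol W)))

instance (W : Opens ℂ) : Algebra ℂ (SFun W) := inferInstanceAs (Algebra ℂ (DualNumber (Hol W)))

namespace SFun

variable {W W' : Opens ℂ}

/-- The superfunction `f + g θ`. -/
def mk (f g : Hol W) : SFun W := (TrivSqZeroExt.inl f + TrivSqZeroExt.inr g : DualNumber (Hol W))

/-- The coefficient `f` of `f + g θ`. -/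
def fst (s : SFun W) : Hol W := TrivSqZeroExt.fst (s : DualNumber (Hol W))

/-- The coefficient `g` of `f + g θ`. -/
def snd (s : SFun W) : Hol W := TrivSqZeroExt.snd (s : DualNumber (Hol W))

/-- `s` is homogeneous of parity `p`. -/
def HasParity (p : ZMod 2) (s : SFun W) : Prop :=
  if p = 0 then s.snd = 0 else s.fst = 0

/-- The parity involution, `s ↦ (-1)^{|s|} s` on homogeneous elements. -/
def inv (s : SFun W) : SFun W := mk s.fst (-s.snd)

/-- `∂_z`. -/
def dz (s : SFun W) : SFun W := mk (Hol.deriv s.fst) (Hol.deriv s.snd)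

/-- `∂_θ`. -/
def dθ (s : SFun W) : SFun W := mk s.snd 0

/-- The even coordinate `z`. -/
def z (W : Opens ℂ) : SFun W := mk ⟨fun x => x, fun x => x, differentiableOn_id, fun _ => rfl⟩ 0

/-- The odd coordinate `θ`. -/
def θ (W : Opens ℂ) : SFun W := mk 0 1

lemma θ_mul_θ (W : Opens ℂ) : θ W * θ W = 0 := by
  have h : θ W = (DualNumber.eps : DualNumber (Hol W)) := by
    refine TrivSqZeroExt.ext ?_ ?_ <;> simp [θ, mk]
  rw [h]
  exact DualNumber.eps_mul_eps

/-- The superfunction `1/z` on an open set that does not contain `0`. -/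
def invZ (h : ∀ x ∈ W, x ≠ 0) : SFun W :=
  mk ⟨fun x => (x : ℂ)⁻¹, fun x => x⁻¹,
    fun x hx => (differentiableAt_inv (h x hx)).differentiableWithinAt, fun _ => rfl⟩ 0

/-- The superfunction `θ/z` on an open set that does not contain `0`. -/
def invθ (h : ∀ x ∈ W, x ≠ 0) : SFun W := θ W * invZ h

/-- Substitution: the homomorphism that is `φ` on functions of `z` and sends `θ` to `c θ`. -/
def subst (φ : Hol W →ₐ[ℂ] Hol W') (c : SFun W') : SFun W →ₐ[ℂ] SFun W' :=
  (DualNumber.lift ⟨((TrivSqZeroExt.inlAlgHom ℂ (Hol W') (Hol W')).comp φ, θ W' * c), by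
    change θ W' * c * (θ W' * c) = 0
    rw [mul_mul_mul_comm, θ_mul_θ, zero_mul], fun _ => mul_comm _ _⟩ :
      DualNumber (Hol W) →ₐ[ℂ] DualNumber (Hol W'))

@[simp] lemma fst_mk (f g : Hol W) : (mk f g).fst = f := by simp [fst, mk]

@[simp] lemma snd_mk (f g : Hol W) : (mk f g).snd = g := by simp [snd, mk]

@[simp] lemma fst_zero : (0 : SFun W).fst = 0 := rfl

@[simp] lemma snd_zero : (0 : SFun W).snd = 0 := rfl

@[simp] lemma fst_one : (1 : SFun W).fst = 1 := rfl

@[simp] lemma snd_one : (1 : SFun W).snd = 0 := rfl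

@[simp] lemma fst_add (s t : SFun W) : (s + t).fst = s.fst + t.fst := rfl

@[simp] lemma snd_add (s t : SFun W) : (s + t).snd = s.snd + t.snd := rfl

@[simp] lemma fst_mul (s t : SFun W) : (s * t).fst = s.fst * t.fst :=
  TrivSqZeroExt.fst_mul (R := Hol W) (M := Hol W) s t

@[simp] lemma snd_mul (s t : SFun W) : (s * t).snd = s.fst * t.snd + t.fst * s.snd := by
  refine (TrivSqZeroExt.snd_mul (R := Hol W) (M := Hol W) s t).trans ?_
  rw [op_smul_eq_smul]
  rfl

lemma subst_apply (φ : Hol W →ₐ[ℂ] Hol W') (c : SFun W') (s : SFun W) :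
    subst φ c s = mk (φ s.fst) 0 + mk (φ s.snd) 0 * (θ W' * c) := by
  refine (DualNumber.lift_apply_apply (R := ℂ) (A := Hol W) (B := DualNumber (Hol W')) _ _).trans ?_
  simp only [mk, TrivSqZeroExt.inr_zero, add_zero]
  rfl

@[simp] lemma fst_subst (φ : Hol W →ₐ[ℂ] Hol W') (c : SFun W') (s : SFun W) :
    (subst φ c s).fst = φ s.fst := by
  simp [subst_apply, θ]

@[simp] lemma snd_subst (φ : Hol W →ₐ[ℂ] Hol W') (c : SFun W') (s : SFun W) :
    (subst φ c s).snd = φ s.snd * c.fst := by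
  simp [subst_apply, θ]

lemma HasParity.subst {p : ZMod 2} {s : SFun W} (hs : s.HasParity p) (φ : Hol W →ₐ[ℂ] Hol W')
    (c : SFun W') : (subst φ c s).HasParity p := by
  unfold HasParity at hs ⊢
  split_ifs at hs ⊢ <;> simp [hs]

/-- Restriction of superfunctions. -/
def res (h : W' ≤ W) : SFun W →ₐ[ℂ] SFun W' :=
  subst (Hol.comp (fun x => x) differentiableOn_id (fun _ hw => h hw)) 1

end SFun

/-- `W` (an open set in the affine chart with coordinates `z₁₀ | θ₁₀`) and `W'` (an open set in
the affine chart with coordinates `z₀₁ | θ₁₁`) lie in the overlap of the two charts, and the change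
of coordinates `z₁₀ = 1 / z₀₁` maps `W'` into `W`. -/
structure Overlap (W W' : Opens ℂ) : Prop where
  ne : ∀ x ∈ W, x ≠ 0
  ne' : ∀ x ∈ W', x ≠ 0
  inv_mem : ∀ w ∈ W', w⁻¹ ∈ W

/-- The change of coordinates of `ℙ^{1|1}`: substitution of `z₁₀ = 1 / z₀₁`, `θ₁₀ = θ₁₁ / z₀₁`
into superfunctions of `z₁₀ | θ₁₀`. -/
def trans {W W' : Opens ℂ} (h : Overlap W W') : SFun W →ₐ[ℂ] SFun W' :=
  SFun.subst (Hol.comp (fun x => x⁻¹)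
    (fun x hx => (differentiableAt_inv (h.ne' x hx)).differentiableWithinAt) h.inv_mem)
    (SFun.invZ h.ne')

/-! ### The parity-shifted tangent sheaf in a chart -/

/-- Sections of the parity-shifted tangent sheaf over `W`: the pair `(a, b)` is
`a • π∂_θ + b • π∂_z`, where the superderivations of the superfunctions over `W` are the
`a ∂_θ + b ∂_z`. Here `π∂_θ` is even and `π∂_z` is odd. -/
abbrev PiT (W : Opens ℂ) : Type := SFun W × SFun W

namespace PiT

variable {W W' : Opens ℂ}

/-- `X = a • π∂_θ + b • π∂_z` is homogeneous of parity `p`. -/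
def HasParity (p : ZMod 2) (X : PiT W) : Prop :=
  X.1.HasParity p ∧ X.2.HasParity (p + 1)

/-- The vector field `a ∂_θ + b ∂_z` applied to a superfunction. -/
def app (X : PiT W) (f : SFun W) : SFun W := X.1 * f.dθ + X.2 * f.dz

/-- Restriction. -/
def res (h : W' ≤ W) : PiT W →ₛₗ[(SFun.res h : SFun W →+* SFun W')] PiT W' where
  toFun X := (SFun.res h X.1, SFun.res h X.2)
  map_add' X Y := by simp
  map_smul' a X := by simp

/-- Change of coordinates by the chain rule: the components of a vector field `X` in the
coordinates `z₀₁ | θ₁₁` are `X(θ₁₁)` and `X(z₀₁)`, where `z₀₁ = 1 / z₁₀`, `θ₁₁ = θ₁₀ / z₁₀`. -/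
def trans (h : Overlap W W') : PiT W →ₛₗ[(SuperP1.trans h : SFun W →+* SFun W')] PiT W' where
  toFun X := (SuperP1.trans h (X.app (SFun.invθ h.ne)), SuperP1.trans h (X.app (SFun.invZ h.ne)))
  map_add' X Y := by
    ext1 <;> simp only [app, Prod.fst_add, Prod.snd_add, map_add, map_mul] <;> ring
  map_smul' a X := by
    ext1 <;> simp only [app, Prod.smul_fst, Prod.smul_snd, smul_eq_mul, map_add, map_mul,
      RingHom.coe_coe] <;> ring

lemma hasParity_res (h : W' ≤ W) (p : ZMod 2) (X : PiT W) (hX : X.HasParity p) :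
    (res h X).HasParity p :=
  ⟨hX.1.subst _ _, hX.2.subst _ _⟩

lemma hasParity_trans (h : Overlap W W') (p : ZMod 2) (X : PiT W) (hX : X.HasParity p) :
    (trans h X).HasParity p := by
  obtain ⟨h1, h2⟩ := hX
  have hc : ∀ q : ZMod 2, q = 0 ∨ q = 1 := by decide
  have h10 : (1 : ZMod 2) ≠ 0 := by decide
  have h11 : (1 : ZMod 2) + 1 = 0 := by decide
  have hd : Hol.deriv (0 : Hol W) = 0 := by
    ext x
    have : Function.extend (Subtype.val : W → ℂ) (0 : W → ℂ) 0 = 0 := by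
      ext y
      by_cases hy : ∃ a : W, (a : ℂ) = y
      · obtain ⟨a, rfl⟩ := hy
        exact Subtype.val_injective.extend_apply _ _ a
      · exact Function.extend_apply' _ _ _ hy
    change deriv (Function.extend (Subtype.val : W → ℂ) (0 : W → ℂ) 0) x = 0
    rw [this]
    simp
  constructor
  · refine SFun.HasParity.subst ?_ _ _
    rcases hc p with rfl | rfl <;>
      simp_all [SFun.HasParity, app, SFun.dz, SFun.dθ, SFun.invθ, SFun.invZ, SFun.θ]
  · refine SFun.HasParity.subst ?_ _ _
    rcases hc p with rfl | rfl <;>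
      simp_all [SFun.HasParity, app, SFun.dz, SFun.dθ, SFun.invZ]

end PiT

/-! ### Supersymmetric powers -/

/-- The Koszul sign `(-1)^{ij}`. -/
def sgn (i j : ZMod 2) : ℤ := (-1) ^ (i.val * j.val)

section Sym

variable {R M : Type} [CommRing R] [Algebra ℂ R] [AddCommGroup M] [Module R M]

/-- The relations of the supersymmetric algebra of a supermodule `M` over a supercommutative
`ℂ`-algebra `R`; `pR p a`, `pM p m` say that `a`, `m` are homogeneous of parity `p`. -/
inductive SymRel (pR : ZMod 2 → R → Prop) (pM : ZMod 2 → M → Prop) :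
    FreeAlgebra ℂ (R ⊕ M) → FreeAlgebra ℂ (R ⊕ M) → Prop
  | algebraMap (c : ℂ) : SymRel pR pM (FreeAlgebra.ι ℂ (Sum.inl (algebraMap ℂ R c)))
      (algebraMap ℂ (FreeAlgebra ℂ (R ⊕ M)) c)
  | coef_add (a b : R) : SymRel pR pM (FreeAlgebra.ι ℂ (Sum.inl (a + b)))
      (FreeAlgebra.ι ℂ (Sum.inl a) + FreeAlgebra.ι ℂ (Sum.inl b))
  | coef_mul (a b : R) : SymRel pR pM (FreeAlgebra.ι ℂ (Sum.inl (a * b)))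
      (FreeAlgebra.ι ℂ (Sum.inl a) * FreeAlgebra.ι ℂ (Sum.inl b))
  | add (m n : M) : SymRel pR pM (FreeAlgebra.ι ℂ (Sum.inr (m + n)))
      (FreeAlgebra.ι ℂ (Sum.inr m) + FreeAlgebra.ι ℂ (Sum.inr n))
  | smul (a : R) (m : M) : SymRel pR pM (FreeAlgebra.ι ℂ (Sum.inr (a • m)))
      (FreeAlgebra.ι ℂ (Sum.inl a) * FreeAlgebra.ι ℂ (Sum.inr m))
  | coef_comm (i j : ZMod 2) (a : R) (m : M) (ha : pR i a) (hm : pM j m) :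
      SymRel pR pM (FreeAlgebra.ι ℂ (Sum.inr m) * FreeAlgebra.ι ℂ (Sum.inl a))
        ((sgn i j : FreeAlgebra ℂ (R ⊕ M)) *
          (FreeAlgebra.ι ℂ (Sum.inl a) * FreeAlgebra.ι ℂ (Sum.inr m)))
  | comm (i j : ZMod 2) (m n : M) (hm : pM i m) (hn : pM j n) :
      SymRel pR pM (FreeAlgebra.ι ℂ (Sum.inr m) * FreeAlgebra.ι ℂ (Sum.inr n))
        ((sgn i j : FreeAlgebra ℂ (R ⊕ M)) *
          (FreeAlgebra.ι ℂ (Sum.inr n) * FreeAlgebra.ι ℂ (Sum.inr m)))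

/-- The supersymmetric algebra `Sym M` of a supermodule `M` over `R`. -/
def SymAlg (pR : ZMod 2 → R → Prop) (pM : ZMod 2 → M → Prop) : Type := RingQuot (SymRel pR pM)

variable {pR : ZMod 2 → R → Prop} {pM : ZMod 2 → M → Prop}

instance : Ring (SymAlg pR pM) := inferInstanceAs (Ring (RingQuot (SymRel pR pM)))

instance : Algebra ℂ (SymAlg pR pM) := inferInstanceAs (Algebra ℂ (RingQuot (SymRel pR pM)))

namespace SymAlg

/-- The quotient map from the free algebra. -/
def mk (pR : ZMod 2 → R → Prop) (pM : ZMod 2 → M → Prop) :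
    FreeAlgebra ℂ (R ⊕ M) →ₐ[ℂ] SymAlg pR pM :=
  RingQuot.mkAlgHom ℂ (SymRel pR pM)

lemma mk_rel {x y : FreeAlgebra ℂ (R ⊕ M)} (h : SymRel pR pM x y) : mk pR pM x = mk pR pM y :=
  RingQuot.mkAlgHom_rel ℂ h

/-- The coefficients inside `Sym M`. -/
def coef (pR : ZMod 2 → R → Prop) (pM : ZMod 2 → M → Prop) : R →ₐ[ℂ] SymAlg pR pM where
  toFun a := mk pR pM (FreeAlgebra.ι ℂ (Sum.inl a))
  map_one' := by simpa using mk_rel (pR := pR) (pM := pM) (SymRel.algebraMap 1)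
  map_mul' a b := by simpa using mk_rel (pR := pR) (pM := pM) (SymRel.coef_mul a b)
  map_zero' := by simpa using mk_rel (pR := pR) (pM := pM) (SymRel.algebraMap 0)
  map_add' a b := by simpa using mk_rel (pR := pR) (pM := pM) (SymRel.coef_add a b)
  commutes' c := (mk_rel (SymRel.algebraMap c)).trans ((mk pR pM).commutes c)

/-- `Sym M` as a left module over the coefficients. -/
instance : Module R (SymAlg pR pM) := Module.compHom _ (coef pR pM).toRingHom

lemma smul_def (a : R) (x : SymAlg pR pM) : a • x = coef pR pM a * x := rfl

/-- The generators. -/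
def gen (pR : ZMod 2 → R → Prop) (pM : ZMod 2 → M → Prop) : M →ₗ[R] SymAlg pR pM where
  toFun m := mk pR pM (FreeAlgebra.ι ℂ (Sum.inr m))
  map_add' m n := by simpa using mk_rel (pR := pR) (pM := pM) (SymRel.add m n)
  map_smul' a m := by
    exact (mk_rel (pR := pR) (pM := pM) (SymRel.smul a m)).trans (map_mul _ _ _)

end SymAlg

/-- The supersymmetric power `Sym^n M`: the `R`-span of the `n`-fold products of elements
of `M`. -/
def SymPow (pR : ZMod 2 → R → Prop) (pM : ZMod 2 → M → Prop) (n : ℕ) :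
    Submodule R (SymAlg pR pM) :=
  Submodule.span R (Set.range fun m : Fin n → M => (List.ofFn fun i => SymAlg.gen pR pM (m i)).prod)

/-- The elements of `Sym^n M` of parity `p`. -/
def SymPow.parity (pR : ZMod 2 → R → Prop) (pM : ZMod 2 → M → Prop) (n : ℕ) (p : ZMod 2) :
    AddSubgroup (SymPow pR pM n) :=
  AddSubgroup.closure {x | ∃ (i : ZMod 2) (a : R) (q : Fin n → ZMod 2) (m : Fin n → M),
    pR i a ∧ (∀ l, pM (q l) (m l)) ∧ i + ∑ l, q l = p ∧
      (x : SymAlg pR pM) = a • (List.ofFn fun l => SymAlg.gen pR pM (m l)).prod}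

variable {R' M' : Type} [CommRing R'] [Algebra ℂ R'] [AddCommGroup M'] [Module R' M']
  {pR' : ZMod 2 → R' → Prop} {pM' : ZMod 2 → M' → Prop}

/-- Functoriality of the supersymmetric algebra. -/
def SymAlg.map (φ : R →ₐ[ℂ] R') (τ : M →ₛₗ[(φ : R →+* R')] M') (hφ : ∀ p a, pR p a → pR' p (φ a))
    (hτ : ∀ p m, pM p m → pM' p (τ m)) : SymAlg pR pM →ₐ[ℂ] SymAlg pR' pM' :=
  RingQuot.liftAlgHom ℂ ⟨FreeAlgebra.lift ℂ
    (Sum.elim (fun a => SymAlg.coef pR' pM' (φ a)) (fun m => SymAlg.gen pR' pM' (τ m))), by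
      intro x y h
      induction h with
      | algebraMap c =>
        simp only [FreeAlgebra.lift_ι_apply, Sum.elim_inl, AlgHom.commutes]
      | coef_add a b => simp
      | coef_mul a b => simp
      | add m n =>
        simp only [FreeAlgebra.lift_ι_apply, Sum.elim_inr, map_add]
      | smul a m =>
        simp only [FreeAlgebra.lift_ι_apply, Sum.elim_inl, Sum.elim_inr, map_mul, map_smulₛₗ,
          RingHom.id_apply, SymAlg.smul_def]
        rfl
      | coef_comm i j a m ha hm =>
        simp only [FreeAlgebra.lift_ι_apply, Sum.elim_inl, Sum.elim_inr, map_mul, map_intCast]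
        have := SymAlg.mk_rel (SymRel.coef_comm (pM := pM') i j _ _ (hφ i a ha) (hτ j m hm))
        simp only [map_mul, map_intCast] at this
        exact this
      | comm i j m n hm hn =>
        simp only [FreeAlgebra.lift_ι_apply, Sum.elim_inr, map_mul, map_intCast]
        have := SymAlg.mk_rel (SymRel.comm (pR := pR') i j _ _ (hτ i m hm) (hτ j n hn))
        simp only [map_mul, map_intCast] at this
        exact this⟩

lemma SymAlg.map_coef (φ : R →ₐ[ℂ] R') (τ : M →ₛₗ[(φ : R →+* R')] M')
    (hφ : ∀ p a, pR p a → pR' p (φ a)) (hτ : ∀ p m, pM p m → pM' p (τ m)) (a : R) :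
    SymAlg.map φ τ hφ hτ (SymAlg.coef pR pM a) = SymAlg.coef pR' pM' (φ a) := by
  refine (RingQuot.liftAlgHom_mkAlgHom_apply ℂ _ _ _).trans ?_
  simp

lemma SymAlg.map_gen (φ : R →ₐ[ℂ] R') (τ : M →ₛₗ[(φ : R →+* R')] M')
    (hφ : ∀ p a, pR p a → pR' p (φ a)) (hτ : ∀ p m, pM p m → pM' p (τ m)) (m : M) :
    SymAlg.map φ τ hφ hτ (SymAlg.gen pR pM m) = SymAlg.gen pR' pM' (τ m) := by
  refine (RingQuot.liftAlgHom_mkAlgHom_apply ℂ _ _ _).trans ?_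
  simp

/-- Functoriality of the supersymmetric powers. -/
def SymPow.map (φ : R →ₐ[ℂ] R') (τ : M →ₛₗ[(φ : R →+* R')] M') (hφ : ∀ p a, pR p a → pR' p (φ a))
    (hτ : ∀ p m, pM p m → pM' p (τ m)) (n : ℕ) :
    SymPow pR pM n →ₛₗ[(φ : R →+* R')] SymPow pR' pM' n where
  toFun x := ⟨SymAlg.map φ τ hφ hτ x, by
    have hs : ∀ (a : R) (y : SymAlg pR pM),
        SymAlg.map φ τ hφ hτ (a • y) = φ a • SymAlg.map φ τ hφ hτ y := fun a y => by
      rw [SymAlg.smul_def, map_mul, SymAlg.map_coef, SymAlg.smul_def]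
    obtain ⟨x, hx⟩ := x
    refine Submodule.span_induction ?_ ?_ ?_ ?_ hx
    · rintro _ ⟨m, rfl⟩
      refine Submodule.subset_span ⟨fun i => τ (m i), ?_⟩
      simp only [map_list_prod, List.map_ofFn]
      congr 2
      funext i
      exact (SymAlg.map_gen φ τ hφ hτ (m i)).symm
    · simp
    · intro y z _ _ hy hz
      simpa using add_mem hy hz
    · intro a y _ hy
      simpa only [hs] using Submodule.smul_mem _ (φ a) hy⟩
  map_add' x y := by ext1; simp
  map_smul' a x := by
    ext1
    change SymAlg.map φ τ hφ hτ (a • (x : SymAlg pR pM)) = φ a • SymAlg.map φ τ hφ hτ x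
    rw [SymAlg.smul_def, map_mul, SymAlg.map_coef, SymAlg.smul_def]

end Sym

/-! ### Gluing over the two charts of `ℙ^{1|1}` -/

/-- The two affine charts `ℂ → ℙ¹` of the projective line (the one-point compactification of `ℂ`):
the chart `0` has the coordinate `z₁₀ = x`, the chart `1` has the coordinate `z₀₁ = 1 / x`. -/
def pt (i : Fin 2) (w : ℂ) : OnePoint ℂ :=
  if i = 0 then (w : OnePoint ℂ) else if w = 0 then OnePoint.infty else ((w⁻¹ : ℂ) : OnePoint ℂ)

lemma continuous_pt (i : Fin 2) : Continuous (pt i) := by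
  by_cases hi : i = 0
  · have : pt i = fun w : ℂ => (w : OnePoint ℂ) := by ext1 w; simp [pt, hi]
    rw [this]
    exact OnePoint.continuous_coe
  · rw [continuous_iff_continuousAt]
    intro w
    by_cases hw : w = 0
    · subst hw
      rw [continuousAt_iff_punctured_nhds]
      have h1 : Filter.Tendsto (fun w : ℂ => ((w⁻¹ : ℂ) : OnePoint ℂ)) (nhdsWithin 0 {0}ᶜ)
          (nhds OnePoint.infty) := by
        have h2 : Filter.Tendsto (fun w : ℂ => (w : OnePoint ℂ)) (Filter.coclosedCompact ℂ)
            (nhds OnePoint.infty) := by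
          rw [OnePoint.nhds_infty_eq]
          exact Filter.tendsto_map.mono_right le_sup_left
        refine h2.comp ?_
        rw [Filter.coclosedCompact_eq_cocompact, ← Metric.cobounded_eq_cocompact]
        exact Filter.tendsto_inv₀_nhdsNE_zero
      have h0 : pt i 0 = OnePoint.infty := by simp [pt, hi]
      rw [h0]
      refine h1.congr' ?_
      filter_upwards [self_mem_nhdsWithin] with y hy
      simp only [Set.mem_compl_iff, Set.mem_singleton_iff] at hy
      simp [pt, hi, hy]
    · have h1 : ContinuousAt (fun w : ℂ => ((w⁻¹ : ℂ) : OnePoint ℂ)) w :=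
        OnePoint.continuous_coe.continuousAt.comp (continuousAt_inv₀ hw)
      refine h1.congr ?_
      filter_upwards [isOpen_ne.mem_nhds hw] with y hy
      simp [pt, hi, hy]

/-- The part of an open subset `V` of `ℙ¹` in the chart `i`, as an open subset of `ℂ`. -/
def loc (i : Fin 2) (V : Opens (OnePoint ℂ)) : Opens ℂ := V.comap ⟨pt i, continuous_pt i⟩

lemma loc_mono (i : Fin 2) {V V' : Opens (OnePoint ℂ)} (h : V' ≤ V) : loc i V' ≤ loc i V :=
  fun _ hx => h hx

/-- The part of `V` in the overlap of the charts, in the coordinate of the chart `i`. -/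
def ov (i : Fin 2) (V : Opens (OnePoint ℂ)) : Opens ℂ := loc i V ⊓ ⟨{0}ᶜ, isOpen_compl_singleton⟩

lemma ov_le (i : Fin 2) (V : Opens (OnePoint ℂ)) : ov i V ≤ loc i V := inf_le_left

lemma overlap (V : Opens (OnePoint ℂ)) : Overlap (ov 0 V) (ov 1 V) where
  ne _ hx := hx.2
  ne' _ hx := hx.2
  inv_mem w hw := by
    have h0 : w ≠ 0 := hw.2
    refine ⟨?_, inv_ne_zero h0⟩
    have h1 : pt 1 w ∈ V := hw.1
    change pt 0 w⁻¹ ∈ V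
    simpa [pt, h0] using h1

/-- The structure sheaf of `ℙ^{1|1}`: a section over `V` is a pair of superfunctions on the parts
of `V` in the two charts that correspond to each other under the change of coordinates. -/
def O (V : Opens (OnePoint ℂ)) : Subalgebra ℂ (∀ i : Fin 2, SFun (loc i V)) where
  carrier := {s | trans (overlap V) (SFun.res (ov_le 0 V) (s 0)) = SFun.res (ov_le 1 V) (s 1)}
  mul_mem' := by
    intro s t hs ht
    simp only [Set.mem_ofPred_eq, Pi.mul_apply, map_mul] at *
    rw [hs, ht]
  add_mem' := by
    intro s t hs ht
    simp only [Set.mem_ofPred_eq, Pi.add_apply, map_add] at *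
    rw [hs, ht]
  algebraMap_mem' := by
    intro c
    simp only [Set.mem_ofPred_eq, Pi.algebraMap_apply, AlgHom.commutes]

/-- A sheaf of modules presented in the charts: the same modules of sections `obj W` over open
subsets `W` of `ℂ` in both charts, their restriction maps, and the transition maps from chart `0`
to chart `1`. -/
structure ChartSheaf where
  obj : Opens ℂ → Type
  [addCommGroup : ∀ W, AddCommGroup (obj W)]
  [module : ∀ W, Module (SFun W) (obj W)]
  res : ∀ {W W' : Opens ℂ} (h : W' ≤ W), obj W →ₛₗ[(SFun.res h : SFun W →+* SFun W')] obj W'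
  tr : ∀ {W W' : Opens ℂ} (h : Overlap W W'), obj W →ₛₗ[(trans h : SFun W →+* SFun W')] obj W'

attribute [instance] ChartSheaf.addCommGroup ChartSheaf.module

/-- Pairs of sections over the parts of `V` in the two charts. -/
abbrev Pairs (F : ChartSheaf) (V : Opens (OnePoint ℂ)) : Type := ∀ i : Fin 2, F.obj (loc i V)

instance (F : ChartSheaf) (V : Opens (OnePoint ℂ)) : Module (O V) (Pairs F V) := inferInstance

instance (F : ChartSheaf) (V : Opens (OnePoint ℂ)) (S : Submodule (O V) (Pairs F V)) :
    Module (O V) S := S.module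

instance (F : ChartSheaf) (V : Opens (OnePoint ℂ)) (S : Submodule (O V) (Pairs F V)) :
    SMul (O V) S := S.module.toSMul

/-- The sections over `V` of the sheaf on `ℙ^{1|1}` glued from `F`: pairs of sections in the two
charts that correspond to each other under the transition map. -/
def Glue (F : ChartSheaf) (V : Opens (OnePoint ℂ)) : Submodule (O V) (Pairs F V) where
  carrier := {s | F.tr (overlap V) (F.res (ov_le 0 V) (s 0)) = F.res (ov_le 1 V) (s 1)}
  add_mem' := by
    intro s t hs ht
    simp only [Set.mem_ofPred_eq, Pi.add_apply, map_add] at *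
    rw [hs, ht]
  zero_mem' := by
    change F.tr (overlap V) (F.res (ov_le 0 V) 0) = F.res (ov_le 1 V) 0
    simp only [map_zero]
  smul_mem' := by
    intro c s hs
    have hc : trans (overlap V) (SFun.res (ov_le 0 V) (c.1 0)) = SFun.res (ov_le 1 V) (c.1 1) := c.2
    simp only [Set.mem_ofPred_eq] at *
    change F.tr (overlap V) (F.res (ov_le 0 V) (c.1 0 • s 0)) = F.res (ov_le 1 V) (c.1 1 • s 1)
    simp only [map_smulₛₗ, hs]
    congr 1

/-- `t` is the restriction of `s` to `V'`. -/
def IsRes {F : ChartSheaf} {V V' : Opens (OnePoint ℂ)} (h : V' ≤ V) (s : Pairs F V)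
    (t : Pairs F V') : Prop :=
  ∀ i, F.res (loc_mono i h) (s i) = t i

/-- `S` is a sheaf on `ℙ¹`: it is closed under restriction, and compatible families of sections
over the members of an arbitrary open cover glue uniquely. -/
def IsSheaf {F : ChartSheaf} (S : ∀ V, Submodule (O V) (Pairs F V)) : Prop :=
  (∀ (V V' : Opens (OnePoint ℂ)) (h : V' ≤ V), ∀ s ∈ S V, ∃ t ∈ S V', IsRes h s t) ∧
  ∀ (ι : Type) (V : ι → Opens (OnePoint ℂ)) (s : ∀ j, Pairs F (V j)), (∀ j, s j ∈ S (V j)) →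
    (∀ (j l : ι) (t t' : Pairs F (V j ⊓ V l)),
      IsRes inf_le_left (s j) t → IsRes inf_le_right (s l) t' → t = t') →
    ∃! t : Pairs F (⨆ j, V j), t ∈ S (⨆ j, V j) ∧ ∀ j, IsRes (le_iSup V j) t (s j)

/-! ### Differential forms and the Berezinian sheaf -/

/-- One-forms `u dθ + v dz` (sections of the parity-shifted cotangent sheaf), as pairs `(u, v)`.
Here `dθ` is even and `dz` is odd. -/
abbrev OneForm (W : Opens ℂ) : Type := SFun W × SFun W

/-- `df = dθ ∂_θ f + dz ∂_z f`. Moving the odd `dz` to the right of its coefficient produces the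
sign in the second component. -/
def diff {W : Opens ℂ} (f : SFun W) : OneForm W := (f.dθ, f.dz.inv)

/-- The Berezinian of an even invertible supermatrix `(a | b // c | d)` of size `1|1`. -/
def berezinian {R : Type} [CommRing R] (a b c d : R) : R :=
  (a - b * Ring.inverse d * c) * Ring.inverse d

variable {W W' : Opens ℂ}

/-- The Berezinian of the transition matrix of the parity-shifted cotangent sheaf, whose rows are
the coefficients of `dθ₁₀` and of `dz₁₀` with respect to the frame `dθ₁₁ | dz₀₁`. -/
def jacBer (h : Overlap W W') : SFun W' :=
  berezinian (diff (SFun.invθ h.ne')).1 (diff (SFun.invθ h.ne')).2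
    (diff (SFun.invZ h.ne')).1 (diff (SFun.invZ h.ne')).2

/-- The Berezinian sheaf of `ℙ^{1|1}`, the dual of the Berezinian of the parity-shifted cotangent
sheaf: in each chart it is free on one even generator `𝒟[dz|dθ]` (here `1`), and the generators
transform with the inverse of the Berezinian of the parity-shifted cotangent sheaf. -/
def Ber : ChartSheaf where
  obj W := SFun W
  res h := (RingHomClass.toRingHom (SFun.res h)).toSemilinearMap
  tr h :=
    { toFun := fun f => trans h f * Ring.inverse (jacBer h)
      map_add' := fun f g => by rw [map_add, add_mul]
      map_smul' := fun a f => by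
        simp only [smul_eq_mul, map_mul, RingHom.coe_coe, mul_assoc] }

/-! ### The sheaves `Ber ⊗ Sym^n ΠT` -/

/-- `Sym^n ΠT` over `W`. -/
abbrev SymT (n : ℕ) (W : Opens ℂ) :
    Submodule (SFun W) (SymAlg (SFun.HasParity (W := W)) (PiT.HasParity (W := W))) :=
  SymPow SFun.HasParity PiT.HasParity n

/-- `Ber ⊗ Sym^n ΠT`, presented in the charts: the tensor product of the modules of sections, with
the tensor product of the transition map of `Ber` and the `n`-th supersymmetric power of the
transition map of `ΠT`. As `Ber` has an even generator there are no signs in the tensor product. -/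
def BerSym (n : ℕ) : ChartSheaf where
  obj W := SFun W ⊗[SFun W] SymT n W
  res h := TensorProduct.map (Ber.res h)
    (SymPow.map (SFun.res h) (PiT.res h) (fun _ _ hs => hs.subst _ _) (PiT.hasParity_res h) n)
  tr h := TensorProduct.map (Ber.tr h)
    (SymPow.map (trans h) (PiT.trans h) (fun _ _ hs => hs.subst _ _) (PiT.hasParity_trans h) n)

/-- `(π∂_θ)^n`, the even local generator of `Sym^n ΠT`. -/
def symEven (W : Opens ℂ) (n : ℕ) : SymT n W :=
  ⟨SymAlg.gen SFun.HasParity PiT.HasParity ((1, 0) : PiT W) ^ n, by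
    refine Submodule.subset_span ⟨fun _ => (1, 0), ?_⟩
    simp⟩

/-- `π∂_z (π∂_θ)^{n-1}`, the odd local generator of `Sym^n ΠT` for `n ≥ 1`, and `0` for `n = 0`. -/
def symOdd (W : Opens ℂ) : (n : ℕ) → SymT n W
  | 0 => 0
  | n + 1 => ⟨SymAlg.gen SFun.HasParity PiT.HasParity ((0, 1) : PiT W) *
      SymAlg.gen SFun.HasParity PiT.HasParity ((1, 0) : PiT W) ^ n, by
    refine Submodule.subset_span ⟨Fin.cons (0, 1) fun _ => (1, 0), ?_⟩
    simp [List.ofFn_succ]⟩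

/-- The section `𝒟[dz|dθ] ⊗ (F (π∂_θ)^n + G π∂_z (π∂_θ)^{n-1})` of `Ber ⊗ Sym^n ΠT`. -/
def berSym (n : ℕ) {W : Opens ℂ} (F G : SFun W) : (BerSym n).obj W :=
  (1 : SFun W) ⊗ₜ[SFun W] (F • symEven W n + G • symOdd W n)

/-- The elements of parity `p` of `Ber ⊗ Sym^n ΠT`. -/
def BerSym.parity (n : ℕ) (W : Opens ℂ) (p : ZMod 2) : AddSubgroup ((BerSym n).obj W) :=
  AddSubgroup.map (TensorProduct.mk (SFun W) (SFun W) (SymT n W) 1).toAddMonoidHom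
    (SymPow.parity SFun.HasParity PiT.HasParity n p)

/-! ### Integral forms in the delta-function formalism -/

/-- Integral forms over `W`: the free module on the formal symbols `dz^a δ^{(r)}(dθ)`, `a = 0, 1`,
`r = 0, 1, 2, …`. -/
abbrev Delta (W : Opens ℂ) : Type := Fin 2 × ℕ →₀ SFun W

namespace Delta

/-- The symbol `dz^a δ^{(r)}(dθ)`. -/
def sym (W : Opens ℂ) (a : Fin 2) (r : ℕ) : Delta W := Finsupp.single (a, r) 1

/-- The coefficient of `dz^a δ^{(r)}(dθ)` in an integral form. -/
def coeff (s : Delta W) (a : Fin 2) (r : ℕ) : SFun W := s (a, r)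

/-- Left multiplication by the even `dθ`: `dθ δ^{(r)}(dθ) = - r δ^{(r-1)}(dθ)`. -/
def dθMul (s : Delta W) : Delta W :=
  s.sum fun p f => (-(p.2 : SFun W) * f) • sym W p.1 (p.2 - 1)

/-- Left multiplication by the odd `dz`: `dz f = (-1)^{|f|} f dz` and `dz dz = 0`. -/
def dzMul (s : Delta W) : Delta W :=
  s.sum fun p f => if p.1 = 0 then f.inv • sym W 1 p.2 else 0

/-- Left multiplication by the one-form `u dθ + v dz`. -/
def formMul (ω : OneForm W) (s : Delta W) : Delta W := ω.1 • dθMul s + ω.2 • dzMul s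

/-- `δ^{(r)}(u dθ + v dz)` for `u` even and invertible and `v` odd, by the rescaling rule
`δ^{(r)}(u τ) = u^{-(r+1)} δ^{(r)}(τ)` and the Taylor expansion
`δ^{(r)}(dθ + u⁻¹ v dz) = δ^{(r)}(dθ) + u⁻¹ v dz δ^{(r+1)}(dθ)`, which stops there as `dz dz = 0`. -/
def deltaOf (r : ℕ) (ω : OneForm W) : Delta W :=
  Ring.inverse ω.1 ^ (r + 1) •
    (sym W 0 r + formMul (0, Ring.inverse ω.1 * ω.2) (sym W 0 (r + 1)))

/-- The symbol `dz₁₀^a δ^{(r)}(dθ₁₀)` in the coordinates `z₀₁ | θ₁₁`. -/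
def symTrans (h : Overlap W W') (p : Fin 2 × ℕ) : Delta W' :=
  if p.1 = 0 then deltaOf p.2 (diff (SFun.invθ h.ne'))
  else formMul (diff (SFun.invZ h.ne')) (deltaOf p.2 (diff (SFun.invθ h.ne')))

/-- Change of coordinates of integral forms. -/
def tr (h : Overlap W W') : Delta W →ₛₗ[(trans h : SFun W →+* SFun W')] Delta W' :=
  (Finsupp.linearCombination (SFun W') (symTrans h)).comp
    (Finsupp.mapRange.linearMap (RingHomClass.toRingHom (trans h)).toSemilinearMap)

/-- The differential of integral forms: `d(f dz^a δ^{(r)}(dθ)) = df dz^a δ^{(r)}(dθ)`, as the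
symbols `dz^a δ^{(r)}(dθ)` are closed. -/
def d (s : Delta W) : Delta W := s.sum fun p f => formMul (diff f) (sym W p.1 p.2)

/-- `s` is a combination of the symbols `dz^a δ^{(r)}(dθ)` of form degree `a - r = k`. -/
def HasDegree (k : ℤ) (s : Delta W) : Prop :=
  ∀ (a : Fin 2) (r : ℕ), (a.val : ℤ) - r ≠ k → s.coeff a r = 0

/-- `s` is homogeneous of parity `p`; the symbol `dz^a δ^{(r)}(dθ)` has parity `a + 1`. -/
def HasParity (p : ZMod 2) (s : Delta W) : Prop :=
  ∀ (a : Fin 2) (r : ℕ), (s.coeff a r).HasParity (p + (a.val : ZMod 2) + 1)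

end Delta

/-- Integral forms in the delta-function formalism, presented in the charts. -/
def DeltaForms : ChartSheaf where
  obj W := Delta W
  res h := Finsupp.mapRange.linearMap (RingHomClass.toRingHom (SFun.res h)).toSemilinearMap
  tr h := Delta.tr h

/-- The integral forms of degree `k` over `V`. -/
def DeltaSheaf (k : ℤ) (V : Opens (OnePoint ℂ)) : Submodule (O V) (Pairs DeltaForms V) where
  carrier := {s | s ∈ Glue DeltaForms V ∧ ∀ i, Delta.HasDegree k (s i)}
  add_mem' := fun {s t} hs ht => ⟨add_mem hs.1 ht.1, fun i a r h => by
    change Delta.coeff (s i) a r + Delta.coeff (t i) a r = 0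
    rw [hs.2 i a r h, ht.2 i a r h, add_zero]⟩
  zero_mem' := ⟨zero_mem _, fun _ _ _ _ => rfl⟩
  smul_mem' := fun c s hs => ⟨Submodule.smul_mem _ c hs.1, fun i a r h => by
    change c.1 i * Delta.coeff (s i) a r = 0
    rw [hs.2 i a r h, mul_zero]⟩

/-- The sheaf `Ber ⊗ Sym^n ΠT` on `ℙ^{1|1}`. -/
abbrev BerSymSheaf (n : ℕ) (V : Opens (OnePoint ℂ)) : Submodule (O V) (Pairs (BerSym n) V) :=
  Glue (BerSym n) V

end SuperP1

end

noncomputable section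

namespace SuperP1

/-! ### Calculus and gluing of holomorphic functions on open subsets of ℂ -/

namespace Hol

variable {W W' : Opens ℂ}

/-! Put n = 1 - k. In a chart, both kinds of sections are pairs of superfunctions: the coefficients
of dz δ^{(n)}(dθ) and δ^{(n-1)}(dθ) on one side, of 𝒟 ⊗ (π∂_θ)^n and 𝒟 ⊗ π∂_z (π∂_θ)^{n-1} on the
other. The theorem rests on the fact that one transition map of pairs, `Comp.tr n`, serves both
sides, so that the identity on components is an isomorphism of sheaves.

On the delta side the matrix comes from dθ₁₀ = z⁻¹ dθ + θ z⁻² dz and dz₁₀ = -z⁻² dz, inserted into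
the rule for δ^{(r)} (`Delta.symTrans_zero`, `Delta.symTrans_one`). On the Berezinian side, π∂_θ
becomes z π∂_θ, π∂_z becomes -θz π∂_θ - z² π∂_z, and 𝒟 becomes -z⁻¹ 𝒟 (`PiT.trans_even`,
`PiT.trans_odd`, `inverse_jacBer`); the product is again `Comp.tr n` (`BerSym.tr_berSym`).

Components make sense on the second side only if Sym^n ΠT, a span inside a quotient of a free
algebra, is free on the expected generators. Generation is a normal form argument: coefficients move
to the left, π∂_z moves in front of π∂_θ, and the square of π∂_z vanishes
(`SymT.exists_combination`). Independence follows from a representation of the supersymmetric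
algebra on pairs that separates the two generators (`SymT.act`, `SymT.comps_symEven`,
`SymT.comps_symOdd`).

The differential is likewise one operator on pairs, `Comp.d n`. It commutes with the transition maps
(`Comp.d_tr`), squares to zero (`Comp.d_d`), and is the delta-form differential in components
(`Delta.d_ofComps`).

The remaining statements, namely the sheaf property, isomorphisms, differential and bases over a
chart, depend only on the components and are proved once for the structure `Frame`. It is
instantiated for the integral forms, for Ber ⊗ Sym^n ΠT, and for Ber itself with n = 0. For n = 0
the odd generator is absent, which appears throughout as the condition that the second component is
0. -/

@[ext] lemma ext_apply {f g : Hol W} (h : ∀ x : W, f.1 x = g.1 x) : f = g :=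
  Subtype.ext (funext h)

/-- Near a point of the open set W, the extension by zero agrees with any holomorphic
representative, so it inherits differentiability there. -/
lemma hasDerivAt (f : Hol W) (x : W) :
    HasDerivAt (Function.extend Subtype.val f.1 0) ((deriv f).1 x) (x : ℂ) := by
  obtain ⟨g, hg, h⟩ := f.2
  have hx : DifferentiableAt ℂ g x := (hg x x.2).differentiableAt (W.isOpen.mem_nhds x.2)
  refine DifferentiableAt.hasDerivAt (hx.congr_of_eventuallyEq ?_)
  filter_upwards [W.isOpen.mem_nhds x.2] with y hy
  exact (Subtype.val_injective.extend_apply f.1 0 (⟨y, hy⟩ : W)).trans (h ⟨y, hy⟩)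

lemma extend_apply (f : Hol W) {x : ℂ} (hx : x ∈ W) :
    Function.extend Subtype.val f.1 0 x = f.1 ⟨x, hx⟩ :=
  Subtype.val_injective.extend_apply f.1 0 (⟨x, hx⟩ : W)

/-- Main tool for computing derivatives: since W is open, any function on ℂ that represents f on W
may be differentiated instead of the extension by zero. -/
lemma deriv_apply_eq (f : Hol W) {g : ℂ → ℂ} {g' : ℂ} {x : W} (hg : HasDerivAt g g' x)
    (h : ∀ y : W, f.1 y = g y) : (deriv f).1 x = g' := by
  refine (hasDerivAt f x).unique (hg.congr_of_eventuallyEq ?_)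
  filter_upwards [W.isOpen.mem_nhds x.2] with y hy
  exact (extend_apply f hy).trans (h ⟨y, hy⟩)

/-- The derivative as a derivation of the algebra of holomorphic functions. -/
def derivation (W : Opens ℂ) : Derivation ℂ (Hol W) (Hol W) :=
  Derivation.mk'
    { toFun := deriv
      map_add' := fun f g => by
        ext x
        refine deriv_apply_eq _ ((hasDerivAt f x).add (hasDerivAt g x)) fun y => ?_
        simp
      map_smul' := fun c f => by
        ext x
        refine deriv_apply_eq _ ((hasDerivAt f x).const_mul c) fun y => ?_
        simp }
    fun f g => by
      ext x
      refine (deriv_apply_eq _ ((hasDerivAt f x).mul (hasDerivAt g x)) fun y => ?_).trans ?_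
      · simp
      · simp
        ring

lemma derivation_apply (f : Hol W) : derivation W f = deriv f := rfl

@[simp] lemma deriv_zero : deriv (0 : Hol W) = 0 := (derivation W).map_zero

@[simp] lemma deriv_one : deriv (1 : Hol W) = 0 := (derivation W).map_one_eq_zero

lemma deriv_algebraMap (c : ℂ) : deriv (algebraMap ℂ (Hol W) c) = 0 :=
  (derivation W).map_algebraMap c

@[simp] lemma deriv_natCast (n : ℕ) : deriv (n : Hol W) = 0 :=
  (derivation W).map_natCast n

@[simp] lemma deriv_add (f g : Hol W) : deriv (f + g) = deriv f + deriv g :=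
  (derivation W).map_add f g

@[simp] lemma deriv_neg (f : Hol W) : deriv (-f) = -deriv f := (derivation W).map_neg f

@[simp] lemma deriv_mul (f g : Hol W) : deriv (f * g) = f * deriv g + g * deriv f :=
  (derivation W).leibniz f g

/-- The coordinate function. -/
def coord (W : Opens ℂ) : Hol W := ⟨fun x => x, fun x => x, differentiableOn_id, fun _ => rfl⟩

/-- The inverse of the coordinate function. -/
def coordInv (h : ∀ x ∈ W, x ≠ 0) : Hol W :=
  ⟨fun x => (x : ℂ)⁻¹, fun x => x⁻¹,
    fun x hx => (differentiableAt_inv (h x hx)).differentiableWithinAt, fun _ => rfl⟩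

lemma coord_mul_coordInv (h : ∀ x ∈ W, x ≠ 0) : coord W * coordInv h = 1 := by
  ext x
  exact mul_inv_cancel₀ (h x x.2)

@[simp] lemma deriv_coord : deriv (coord W) = 1 := by
  ext x
  exact deriv_apply_eq _ (hasDerivAt_id (x : ℂ)) fun _ => rfl

@[simp] lemma deriv_coordInv (h : ∀ x ∈ W, x ≠ 0) : deriv (coordInv h) = -coordInv h ^ 2 := by
  ext x
  refine (deriv_apply_eq _ (hasDerivAt_inv (h x x.2)) fun _ => rfl).trans ?_
  simp [coordInv]

lemma deriv_coord_pow_succ (n : ℕ) :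
    deriv (coord W ^ (n + 1)) = ((n : Hol W) + 1) * coord W ^ n := by
  have h := (derivation W).leibniz_pow (a := coord W) (n + 1)
  rw [derivation_apply, derivation_apply, deriv_coord] at h
  rw [h]
  simp

/-- Substitution of `1 / z`. -/
abbrev invComp (h : Overlap W W') : Hol W →ₐ[ℂ] Hol W' :=
  Hol.comp (fun x => x⁻¹)
    (fun x hx => (differentiableAt_inv (h.ne' x hx)).differentiableWithinAt) h.inv_mem

/-- Restriction of holomorphic functions. -/
abbrev res (h : W' ≤ W) : Hol W →ₐ[ℂ] Hol W' :=
  Hol.comp (fun x => x) differentiableOn_id (fun _ hw => h hw)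

lemma deriv_res (h : W' ≤ W) (f : Hol W) : deriv (res h f) = res h (deriv f) := by
  ext x
  exact deriv_apply_eq _ (hasDerivAt f ⟨x, h x.2⟩) fun y => (extend_apply f (h y.2)).symm

/-- The chain rule for w ↦ 1/w, whose derivative is -w⁻². -/
lemma deriv_invComp (h : Overlap W W') (f : Hol W) :
    deriv (invComp h f) = -coordInv h.ne' ^ 2 * invComp h (deriv f) := by
  ext x
  have hx := h.inv_mem x x.2
  refine (deriv_apply_eq _ ((hasDerivAt f ⟨_, hx⟩).comp (x : ℂ)
    (hasDerivAt_inv (h.ne' x x.2))) fun y => ?_).trans ?_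
  · exact (extend_apply f (h.inv_mem y y.2)).symm
  · refine (mul_comm _ _).trans ?_
    rw [← inv_pow]
    rfl

@[simp] lemma res_coord (h : W' ≤ W) : res h (coord W) = coord W' := rfl

@[simp] lemma res_coordInv (h : W' ≤ W) (h0 : ∀ x ∈ W, x ≠ 0) (h0' : ∀ x ∈ W', x ≠ 0) :
    res h (coordInv h0) = coordInv h0' := rfl

@[simp] lemma invComp_coord (h : Overlap W W') : invComp h (coord W) = coordInv h.ne' := rfl

@[simp] lemma invComp_coordInv (h : Overlap W W') :
    invComp h (coordInv h.ne) = coord W' := by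
  ext x
  exact inv_inv _

lemma invComp_invComp (h : Overlap W W') (h' : Overlap W' W) (f : Hol W) :
    invComp h' (invComp h f) = f := by
  ext x
  exact congrArg f.1 (Subtype.ext (inv_inv _))

/-- Holomorphic functions glue. -/
lemma exists_glue {ι : Type} {U : Opens ℂ} {V : ι → Opens ℂ} (hV : ∀ j, V j ≤ U)
    (hU : ∀ x ∈ U, ∃ j, x ∈ V j) (f : ∀ j, Hol (V j))
    (hf : ∀ j l x (hj : x ∈ V j) (hl : x ∈ V l), (f j).1 ⟨x, hj⟩ = (f l).1 ⟨x, hl⟩) :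
    ∃ g : Hol U, ∀ j, res (hV j) g = f j := by
  choose j hj using hU
  let g : U → ℂ := fun x => (f (j x x.2)).1 ⟨x, hj x x.2⟩
  -- The member of the cover used to define g at a point is chosen arbitrarily. Agreement on
  -- intersections makes the choice harmless, so near each point g is a single f j and is therefore
  -- holomorphic.
  have key : ∀ (l : ι) (x : ℂ) (hx : x ∈ V l), g ⟨x, hV l hx⟩ = (f l).1 ⟨x, hx⟩ :=
    fun l x hx => hf _ _ _ _ _
  refine ⟨⟨g, Function.extend Subtype.val g 0, fun x hx => ?_, fun x =>
    (Subtype.val_injective.extend_apply g 0 x).symm⟩, fun l => ?_⟩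
  · refine DifferentiableAt.differentiableWithinAt ?_
    refine (hasDerivAt (f (j x hx)) ⟨x, hj x hx⟩).differentiableAt.congr_of_eventuallyEq ?_
    filter_upwards [(V (j x hx)).isOpen.mem_nhds (hj x hx)] with y hy
    rw [extend_apply _ hy, ← key _ y hy]
    exact Subtype.val_injective.extend_apply g 0 (⟨y, hV _ hy⟩ : U)
  · ext x
    exact key l x x.2

lemma eq_of_res_eq {ι : Type} {U : Opens ℂ} {V : ι → Opens ℂ} (hV : ∀ j, V j ≤ U)
    (hU : ∀ x ∈ U, ∃ j, x ∈ V j) {f g : Hol U} (h : ∀ j, res (hV j) f = res (hV j) g) :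
    f = g := by
  ext x
  obtain ⟨j, hj⟩ := hU x x.2
  exact congrArg (fun k : Hol (V j) => k.1 ⟨x, hj⟩) (h j)

end Hol

/-! ### Superfunctions: components, change of coordinates, gluing, parity -/

namespace SFun

variable {W W' : Opens ℂ}

lemma ext_comp {s t : SFun W} (h₁ : s.fst = t.fst) (h₂ : s.snd = t.snd) : s = t :=
  TrivSqZeroExt.ext h₁ h₂

@[simp] lemma fst_neg (s : SFun W) : (-s).fst = -s.fst := rfl

@[simp] lemma snd_neg (s : SFun W) : (-s).snd = -s.snd := rfl

@[simp] lemma fst_natCast (n : ℕ) : (n : SFun W).fst = n := rfl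

@[simp] lemma snd_natCast (n : ℕ) : (n : SFun W).snd = 0 := rfl

@[simp] lemma fst_algebraMap (c : ℂ) : (algebraMap ℂ (SFun W) c).fst = algebraMap ℂ (Hol W) c :=
  rfl

@[simp] lemma snd_algebraMap (c : ℂ) : (algebraMap ℂ (SFun W) c).snd = 0 := rfl

@[simp] lemma fst_pow (s : SFun W) (n : ℕ) : (s ^ n).fst = s.fst ^ n :=
  TrivSqZeroExt.fst_pow (R := Hol W) (M := Hol W) s n

lemma snd_pow_eq_zero {s : SFun W} (hs : s.snd = 0) (n : ℕ) : (s ^ n).snd = 0 := by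
  induction n with
  | zero => simp
  | succ n ih => simp [pow_succ, ih, hs]

@[simp] lemma fst_z : (z W).fst = Hol.coord W := fst_mk _ _

@[simp] lemma snd_z : (z W).snd = 0 := snd_mk _ _

@[simp] lemma snd_z_pow (n : ℕ) : (z W ^ n).snd = 0 := snd_pow_eq_zero snd_z n

@[simp] lemma fst_θ : (θ W).fst = 0 := fst_mk _ _

@[simp] lemma snd_θ : (θ W).snd = 1 := snd_mk _ _

@[simp] lemma fst_invZ (h : ∀ x ∈ W, x ≠ 0) : (invZ h).fst = Hol.coordInv h := fst_mk _ _

@[simp] lemma snd_invZ (h : ∀ x ∈ W, x ≠ 0) : (invZ h).snd = 0 := snd_mk _ _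

@[simp] lemma fst_dθ (s : SFun W) : s.dθ.fst = s.snd := fst_mk _ _

@[simp] lemma snd_dθ (s : SFun W) : s.dθ.snd = 0 := snd_mk _ _

@[simp] lemma fst_dz (s : SFun W) : s.dz.fst = Hol.deriv s.fst := fst_mk _ _

@[simp] lemma snd_dz (s : SFun W) : s.dz.snd = Hol.deriv s.snd := snd_mk _ _

@[simp] lemma fst_inv (s : SFun W) : s.inv.fst = s.fst := fst_mk _ _

@[simp] lemma snd_inv (s : SFun W) : s.inv.snd = -s.snd := snd_mk _ _

@[simp] lemma fst_res (h : W' ≤ W) (s : SFun W) : (res h s).fst = Hol.res h s.fst :=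
  fst_subst _ _ _

@[simp] lemma snd_res (h : W' ≤ W) (s : SFun W) : (res h s).snd = Hol.res h s.snd := by
  simp [res]

@[simp] lemma fst_trans (h : Overlap W W') (s : SFun W) :
    (trans h s).fst = Hol.invComp h s.fst :=
  fst_subst _ _ _

@[simp] lemma snd_trans (h : Overlap W W') (s : SFun W) :
    (trans h s).snd = Hol.invComp h s.snd * Hol.coordInv h.ne' := by
  simp [trans]

/-- The parity involution as a homomorphism of algebras. -/
def invHom (W : Opens ℂ) : SFun W →ₐ[ℂ] SFun W where
  toFun := inv
  map_one' := by apply ext_comp <;> simp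
  map_mul' s t := by apply ext_comp <;> simp; ring
  map_zero' := by apply ext_comp <;> simp
  map_add' s t := by apply ext_comp <;> simp; ring
  commutes' c := by apply ext_comp <;> simp

@[simp] lemma inv_one : (1 : SFun W).inv = 1 := map_one (invHom W)

@[simp] lemma inv_zero : (0 : SFun W).inv = 0 := map_zero (invHom W)

lemma inv_add (s t : SFun W) : (s + t).inv = s.inv + t.inv := map_add (invHom W) s t

lemma z_mul_invZ (h : ∀ x ∈ W, x ≠ 0) : z W * invZ h = 1 := by
  apply ext_comp <;> simp [Hol.coord_mul_coordInv]

/-- The formulas z ↦ 1/z, θ ↦ θ/z are their own inverse: the coefficient of θ acquires 1/z twice,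
and the first of these factors has become z after the second substitution. -/
lemma trans_trans (h : Overlap W W') (h' : Overlap W' W) (s : SFun W) :
    trans h' (trans h s) = s := by
  apply ext_comp
  · simp only [fst_trans, Hol.invComp_invComp]
  · simp only [snd_trans, map_mul, Hol.invComp_invComp, Hol.invComp_coordInv]
    rw [mul_assoc, Hol.coord_mul_coordInv, mul_one]

@[simp] lemma trans_invZ (h : Overlap W W') : trans h (invZ h.ne) = z W' := by
  apply ext_comp
  · rw [fst_trans, fst_invZ, Hol.invComp_coordInv, fst_z]
  · simp

@[simp] lemma trans_z (h : Overlap W W') : trans h (z W) = invZ h.ne' := by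
  apply ext_comp
  · rw [fst_trans, fst_invZ, fst_z, Hol.invComp_coord]
  · simp

@[simp] lemma trans_θ (h : Overlap W W') : trans h (θ W) = θ W' * invZ h.ne' := by
  apply ext_comp <;> simp

lemma trans_res {W₁ W₁' : Opens ℂ} (h : Overlap W W') (h₁ : Overlap W₁ W₁') (k : W₁ ≤ W)
    (k' : W₁' ≤ W') (s : SFun W) : trans h₁ (res k s) = res k' (trans h s) := by
  apply ext_comp
  · simp only [fst_trans, fst_res]
    rfl
  · simp only [snd_trans, snd_res, map_mul]
    rfl

@[simp] lemma res_z (h : W' ≤ W) : res h (z W) = z W' := by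
  apply ext_comp <;> simp

@[simp] lemma res_θ (h : W' ≤ W) : res h (θ W) = θ W' := by
  apply ext_comp <;> simp

@[simp] lemma res_invZ (h : W' ≤ W) (h0 : ∀ x ∈ W, x ≠ 0) (h0' : ∀ x ∈ W', x ≠ 0) :
    res h (invZ h0) = invZ h0' := by
  apply ext_comp
  · rw [fst_res, fst_invZ, fst_invZ, Hol.res_coordInv]
  · simp

lemma res_self (h : W ≤ W) (s : SFun W) : res h s = s := by
  apply ext_comp
  · rw [fst_res]; rfl
  · rw [snd_res]; rfl

lemma res_res {W'' : Opens ℂ} (h : W' ≤ W) (h' : W'' ≤ W') (s : SFun W) :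
    res h' (res h s) = res (h'.trans h) s := by
  apply ext_comp
  · simp only [fst_res]; rfl
  · simp only [snd_res]; rfl

lemma res_dθ (h : W' ≤ W) (s : SFun W) : res h s.dθ = (res h s).dθ := by
  apply ext_comp <;> simp

lemma res_dz (h : W' ≤ W) (s : SFun W) : res h s.dz = (res h s).dz := by
  apply ext_comp <;> simp [Hol.deriv_res]

lemma res_inv (h : W' ≤ W) (s : SFun W) : res h s.inv = (res h s).inv := by
  apply ext_comp <;> simp

/-- Superfunctions glue. -/
lemma exists_glue {ι : Type} {U : Opens ℂ} {V : ι → Opens ℂ} (hV : ∀ j, V j ≤ U)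
    (hU : ∀ x ∈ U, ∃ j, x ∈ V j) (s : ∀ j, SFun (V j))
    (hs : ∀ j l, res (inf_le_left : V j ⊓ V l ≤ V j) (s j) =
      res (inf_le_right : V j ⊓ V l ≤ V l) (s l)) :
    ∃ t : SFun U, ∀ j, res (hV j) t = s j := by
  obtain ⟨f, hf⟩ := Hol.exists_glue hV hU (fun j => (s j).fst) fun j l x hj hl => by
    have h := congrArg fst (hs j l)
    rw [fst_res, fst_res] at h
    exact congrArg (fun k : Hol (V j ⊓ V l) => k.1 ⟨x, hj, hl⟩) h
  obtain ⟨g, hg⟩ := Hol.exists_glue hV hU (fun j => (s j).snd) fun j l x hj hl => by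
    have h := congrArg snd (hs j l)
    rw [snd_res, snd_res] at h
    exact congrArg (fun k : Hol (V j ⊓ V l) => k.1 ⟨x, hj, hl⟩) h
  refine ⟨mk f g, fun j => ext_comp ?_ ?_⟩
  · rw [fst_res, fst_mk, hf]
  · rw [snd_res, snd_mk, hg]

lemma eq_of_res_eq {ι : Type} {U : Opens ℂ} {V : ι → Opens ℂ} (hV : ∀ j, V j ≤ U)
    (hU : ∀ x ∈ U, ∃ j, x ∈ V j) {s t : SFun U} (h : ∀ j, res (hV j) s = res (hV j) t) :
    s = t := by
  refine ext_comp (Hol.eq_of_res_eq hV hU fun j => ?_) (Hol.eq_of_res_eq hV hU fun j => ?_)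
  · rw [← fst_res, ← fst_res, h]
  · rw [← snd_res, ← snd_res, h]

lemma hasParity_zero_iff {s : SFun W} : s.HasParity 0 ↔ s.snd = 0 := by simp [HasParity]

lemma hasParity_one_iff {s : SFun W} : s.HasParity 1 ↔ s.fst = 0 := by simp [HasParity]

lemma hasParity_zero (p : ZMod 2) : (0 : SFun W).HasParity p := by
  simp [HasParity]

lemma hasParity_one : (1 : SFun W).HasParity 0 := by
  simp [HasParity]

lemma HasParity.add {p : ZMod 2} {s t : SFun W} (hs : s.HasParity p) (ht : t.HasParity p) :
    (s + t).HasParity p := by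
  unfold HasParity at *
  split_ifs at * <;> simp_all

lemma HasParity.mul {p q : ZMod 2} {s t : SFun W} (hs : s.HasParity p) (ht : t.HasParity q) :
    (s * t).HasParity (p + q) := by
  have hc : ∀ q : ZMod 2, q = 0 ∨ q = 1 := by decide
  have h11 : (1 : ZMod 2) + 1 = 0 := by decide
  rcases hc p with rfl | rfl <;> rcases hc q with rfl | rfl <;>
    simp_all [hasParity_zero_iff, hasParity_one_iff]

lemma HasParity.neg {p : ZMod 2} {s : SFun W} (hs : s.HasParity p) : (-s).HasParity p := by
  unfold HasParity at *
  split_ifs at * <;> simp_all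

lemma HasParity.trans {p : ZMod 2} {s : SFun W} (hs : s.HasParity p) (h : Overlap W W') :
    (trans h s).HasParity p :=
  hs.subst _ _

lemma hasParity_invZ (h : ∀ x ∈ W, x ≠ 0) : (invZ h).HasParity 0 := by
  simp [hasParity_zero_iff]

lemma hasParity_z_pow (n : ℕ) : (z W ^ n).HasParity 0 := by
  simp [hasParity_zero_iff]

lemma hasParity_θ : (θ W).HasParity 1 := by
  simp [hasParity_one_iff]

end SFun

/-! ### Components in the local frames -/

namespace Comp

open SFun

variable {W W' : Opens ℂ}

/-- Restriction of the pair of components of a section. -/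
def res (h : W' ≤ W) (c : SFun W × SFun W) : SFun W' × SFun W' :=
  (SFun.res h c.1, SFun.res h c.2)

/-- The common transition map of the integral forms of degree `1 - n` and of `Ber ⊗ Sym^n ΠT`,
in components. -/
def tr (n : ℕ) (h : Overlap W W') (c : SFun W × SFun W) : SFun W' × SFun W' :=
  (-(z W' ^ n * invZ h.ne') * trans h c.1 + θ W' * (z W' ^ n * invZ h.ne') * trans h c.2,
    z W' ^ n * trans h c.2)

/-- The differential in components. -/
def d (n : ℕ) (c : SFun W × SFun W) : SFun W × SFun W :=
  (-((n : SFun W) + 1) * c.1.dθ + c.2.dz.inv, -(n : SFun W) * c.2.dθ)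

lemma res_self (h : W ≤ W) (c : SFun W × SFun W) : res h c = c :=
  Prod.ext (SFun.res_self _ _) (SFun.res_self _ _)

lemma res_res {W'' : Opens ℂ} (h : W' ≤ W) (h' : W'' ≤ W') (c : SFun W × SFun W) :
    res h' (res h c) = res (h'.trans h) c :=
  Prod.ext (SFun.res_res _ _ _) (SFun.res_res _ _ _)

lemma tr_res (n : ℕ) {W₁ W₁' : Opens ℂ} (h : Overlap W W') (h₁ : Overlap W₁ W₁') (k : W₁ ≤ W)
    (k' : W₁' ≤ W') (c : SFun W × SFun W) : tr n h₁ (res k c) = res k' (tr n h c) := by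
  simp only [tr, res, trans_res h h₁ k k', map_add, map_mul, map_neg, map_pow, res_z, res_θ,
    res_invZ k' h.ne' h₁.ne']

/-- The same formula inverts the transition map. The diagonal entries multiply to 1 after z ↦ 1/z,
and the two contributions of the off-diagonal entry cancel; only z · z⁻¹ = 1 and its n-th power are
needed. -/
lemma tr_tr (n : ℕ) (h : Overlap W W') (h' : Overlap W' W) (c : SFun W × SFun W) :
    tr n h' (tr n h c) = c := by
  have h1 := z_mul_invZ h.ne
  have h2 : z W ^ n * invZ h.ne ^ n = 1 := by rw [← mul_pow, h1, one_pow]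
  simp only [tr, map_add, map_mul, map_neg, map_pow, trans_z, trans_θ, trans_invZ h', trans_trans]
  refine Prod.ext ?_ ?_
  · linear_combination
      (z W * invZ h.ne * c.1 - θ W * invZ h.ne * c.2 * z W * invZ h.ne + θ W * invZ h.ne * c.2) * h2
      + (c.1 - θ W * invZ h.ne * c.2) * h1
  · linear_combination c.2 * h2

/-- The transition matrix is triangular, so the pairs that represent sections for n = 0 are
preserved. -/
lemma tr_snd_eq_zero (n : ℕ) (h : Overlap W W') {c : SFun W × SFun W} (hc : c.2 = 0) :
    (tr n h c).2 = 0 := by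
  simp [tr, hc]

/-- The first generator is even and the second is odd, so a section of parity p has components of
parities p and p + 1. The diagonal entries of the transition matrix are even and the off-diagonal
entry, which contains θ, is odd. -/
lemma hasParity_tr (n : ℕ) (h : Overlap W W') {p : ZMod 2} {c : SFun W × SFun W}
    (h₁ : c.1.HasParity p) (h₂ : c.2.HasParity (p + 1)) :
    (tr n h c).1.HasParity p ∧ (tr n h c).2.HasParity (p + 1) := by
  have hz := (hasParity_z_pow (W := W') n).mul (hasParity_invZ h.ne')
  have h11 : (1 : ZMod 2) + (0 + 0) + (p + 1) = p := by
    rw [add_zero, add_zero, add_comm p, ← add_assoc, show (1 : ZMod 2) + 1 = 0 from rfl, zero_add]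
  constructor
  · refine SFun.HasParity.add ?_ ?_
    · simpa using hz.neg.mul (h₁.trans h)
    · have := (hasParity_θ.mul hz).mul (h₂.trans h)
      rwa [h11] at this
  · have := (hasParity_z_pow (W := W') n).mul (h₂.trans h)
    rwa [zero_add] at this

lemma hasParity_res (h : W' ≤ W) {p : ZMod 2} {c : SFun W × SFun W}
    (h₁ : c.1.HasParity p) (h₂ : c.2.HasParity (p + 1)) :
    (res h c).1.HasParity p ∧ (res h c).2.HasParity (p + 1) :=
  ⟨h₁.subst _ _, h₂.subst _ _⟩

lemma d_add (n : ℕ) (c c' : SFun W × SFun W) : d n (c + c') = d n c + d n c' := by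
  refine Prod.ext (ext_comp ?_ ?_) (ext_comp ?_ ?_) <;> simp [d] <;> ring

lemma d_smul (n : ℕ) (a : ℂ) (c : SFun W × SFun W) :
    d n (algebraMap ℂ (SFun W) a • c) = algebraMap ℂ (SFun W) a • d n c := by
  refine Prod.ext (ext_comp ?_ ?_) (ext_comp ?_ ?_) <;>
    simp only [d, Prod.smul_fst, Prod.smul_snd, smul_eq_mul] <;>
    simp [Hol.deriv_algebraMap] <;> ring

lemma d_res (n : ℕ) (h : W' ≤ W) (c : SFun W × SFun W) : d n (res h c) = res h (d n c) := by
  refine Prod.ext ?_ ?_ <;> simp [d, res, res_dθ, res_dz, res_inv]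

/-- The operator ∂_θ squares to zero, and the mixed terms ∂_θ ∂_z cancel because the parity
involution changes the sign of the θ-coefficient of ∂_z G before ∂_θ extracts it. -/
lemma d_d (n : ℕ) (c : SFun W × SFun W) : d n (d (n + 1) c) = 0 := by
  refine Prod.ext (ext_comp ?_ ?_) (ext_comp ?_ ?_) <;> simp [d]
  ring

lemma d_zero_snd (c : SFun W × SFun W) : (d 0 c).2 = 0 := by simp [d]

/-- This is why the differential is global. For the even part of the second component, -(n+1) ∂_θ
applied to the off-diagonal term cancels the term (n+1) z^n produced when ∂_z hits z^{n+1}. For the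
odd part, the extra factor 1/z from θ leaves n z^{n-1}, which is the off-diagonal term of the
transition map for n. -/
lemma d_tr (n : ℕ) (h : Overlap W W') (c : SFun W × SFun W) :
    d n (tr (n + 1) h c) = tr n h (d n c) := by
  have h1 := Hol.coord_mul_coordInv h.ne'
  have h2 : Hol.coord W' ^ (n + 1) * Hol.coordInv h.ne' = Hol.coord W' ^ n := by
    rw [pow_succ, mul_assoc, h1, mul_one]
  refine Prod.ext (ext_comp ?_ ?_) (ext_comp ?_ ?_) <;>
    simp [d, tr, Hol.deriv_coord_pow_succ, Hol.deriv_invComp, -neg_add_rev]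
  · linear_combination ((n + 1) * Hol.invComp h c.1.snd * Hol.coordInv h.ne' -
      (n + 1) * Hol.invComp h c.2.fst -
      Hol.coordInv h.ne' * Hol.invComp h (Hol.deriv c.2.fst)) * h2
  · linear_combination (Hol.coordInv h.ne' * Hol.invComp h c.2.snd +
      Hol.coordInv h.ne' ^ 2 * Hol.invComp h (Hol.deriv c.2.snd)) * h2
  · linear_combination n * Hol.invComp h c.2.snd * h2

end Comp

/-! ### The local frame of `Sym^n ΠT` -/

namespace SymT

open SFun

variable {W W' : Opens ℂ}

/-- The action of a generator of `Sym ΠT` on pairs of components, where the powers of `π∂_θ` are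
not recorded: `(a π∂_θ + b π∂_z) (p + q π∂_z) = a p + (a q + b (-1)^{|p|} p) π∂_z`. -/
def actGen (m : PiT W) : Module.End ℂ (SFun W × SFun W) where
  toFun p := (m.1 * p.1, m.1 * p.2 + m.2 * p.1.inv)
  map_add' p q := by
    refine Prod.ext ?_ ?_
    · simp [mul_add]
    · simp [mul_add, inv_add]
      ring
  map_smul' c p := by
    have h : (c • p.1).inv = c • p.1.inv := map_smul (invHom W) c p.1
    refine Prod.ext ?_ ?_ <;> simp [h]

lemma actGen_apply (m : PiT W) (p : SFun W × SFun W) :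
    actGen m p = (m.1 * p.1, m.1 * p.2 + m.2 * p.1.inv) := rfl

/-- The action of the coefficients on pairs of components. -/
def actCoef (W : Opens ℂ) : SFun W →ₐ[ℂ] Module.End ℂ (SFun W × SFun W) :=
  Algebra.lsmul ℂ ℂ (SFun W × SFun W)

lemma actCoef_apply (a : SFun W) (p : SFun W × SFun W) : actCoef W a p = a • p := rfl

/-- The supersymmetric algebra of `ΠT` acting on pairs of components. -/
def act (W : Opens ℂ) :
    SymAlg (SFun.HasParity (W := W)) (PiT.HasParity (W := W)) →ₐ[ℂ]
      Module.End ℂ (SFun W × SFun W) :=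
  RingQuot.liftAlgHom ℂ ⟨FreeAlgebra.lift ℂ (Sum.elim (actCoef W) actGen), by
    have hc : ∀ q : ZMod 2, q = 0 ∨ q = 1 := by decide
    have h11 : (1 : ZMod 2) + 1 = 0 := by decide
    have h1 : ZMod.val (1 : ZMod 2) = 1 := rfl
    have s00 : sgn 0 0 = 1 := rfl
    have s01 : sgn 0 1 = 1 := rfl
    have s10 : sgn 1 0 = 1 := rfl
    have s11 : sgn 1 1 = -1 := rfl
    intro x y h
    induction h with
    | algebraMap c => simp
    | coef_add a b => simp
    | coef_mul a b => simp
    | add m n =>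
      simp only [FreeAlgebra.lift_ι_apply, Sum.elim_inr, map_add]
      refine LinearMap.ext fun p => Prod.ext ?_ ?_ <;> simp [actGen_apply] <;> ring
    | smul a m =>
      simp only [FreeAlgebra.lift_ι_apply, Sum.elim_inr, Sum.elim_inl, map_mul]
      refine LinearMap.ext fun p => Prod.ext ?_ ?_ <;>
        simp [actGen_apply, actCoef_apply] <;> ring
    | coef_comm i j a m ha hm =>
      simp only [FreeAlgebra.lift_ι_apply, Sum.elim_inl, Sum.elim_inr, map_mul, map_intCast]
      obtain ⟨hm1, hm2⟩ := hm
      refine LinearMap.ext fun p => ?_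
      -- Homogeneity kills one coefficient of each superfunction involved. In each of the four
      -- parity cases what remains is an identity in a commutative ring, with the Koszul sign
      -- matched by the parity involution in `actGen`.
      rcases hc i with rfl | rfl <;> rcases hc j with rfl | rfl <;>
        simp only [h11, zero_add, hasParity_zero_iff, hasParity_one_iff] at ha hm1 hm2 <;>
        refine Prod.ext (ext_comp ?_ ?_) (ext_comp ?_ ?_) <;>
        simp [s00, s01, s10, s11, actGen_apply, actCoef_apply, ha, hm1, hm2] <;> ring
    | comm i j m n hm hn =>
      simp only [FreeAlgebra.lift_ι_apply, Sum.elim_inr, map_mul, map_intCast]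
      obtain ⟨hm1, hm2⟩ := hm
      obtain ⟨hn1, hn2⟩ := hn
      refine LinearMap.ext fun p => ?_
      rcases hc i with rfl | rfl <;> rcases hc j with rfl | rfl <;>
        simp only [h11, zero_add, hasParity_zero_iff, hasParity_one_iff] at hm1 hm2 hn1 hn2 <;>
        refine Prod.ext (ext_comp ?_ ?_) (ext_comp ?_ ?_) <;>
        simp [s00, s01, s10, s11, actGen_apply, hm1, hm2, hn1, hn2] <;> ring⟩

lemma act_coef (a : SFun W) : act W (SymAlg.coef _ _ a) = actCoef W a := by
  refine (RingQuot.liftAlgHom_mkAlgHom_apply ℂ _ _ _).trans ?_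
  simp

lemma act_gen (m : PiT W) : act W (SymAlg.gen _ _ m) = actGen m := by
  refine (RingQuot.liftAlgHom_mkAlgHom_apply ℂ _ _ _).trans ?_
  simp

/-- The components of an element of the supersymmetric algebra of `ΠT`. -/
def comps (W : Opens ℂ) :
    SymAlg (SFun.HasParity (W := W)) (PiT.HasParity (W := W)) →ₗ[SFun W] SFun W × SFun W where
  toFun x := act W x (1, 0)
  map_add' x y := by simp
  map_smul' a x := by
    rw [SymAlg.smul_def, map_mul, act_coef]
    rfl

/-- The action forgets powers of π∂_θ, which loses nothing in a fixed degree n. -/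
lemma actGen_even_pow (n : ℕ) (p : SFun W × SFun W) : (actGen ((1, 0) : PiT W) ^ n) p = p := by
  have h : actGen ((1, 0) : PiT W) = 1 := LinearMap.ext fun p => by simp [actGen_apply]
  rw [h, one_pow, Module.End.one_apply]

/-- Together with `comps_symOdd` this gives the independence of the two generators: a linear map
sends them to the standard basis of pairs. -/
lemma comps_symEven (n : ℕ) : comps W (symEven W n) = (1, 0) := by
  change act W (SymAlg.gen _ _ _ ^ n) (1, 0) = _
  rw [map_pow, act_gen, actGen_even_pow]

lemma comps_symOdd (n : ℕ) : comps W (symOdd W (n + 1)) = (0, 1) := by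
  change act W (SymAlg.gen _ _ _ * SymAlg.gen _ _ _ ^ n) (1, 0) = _
  rw [map_mul, map_pow, act_gen, act_gen, Module.End.mul_apply, actGen_even_pow]
  simp [actGen_apply]

local notation "gen" W => SymAlg.gen (SFun.HasParity (W := W)) (PiT.HasParity (W := W))

local notation "coef" W => SymAlg.coef (SFun.HasParity (W := W)) (PiT.HasParity (W := W))

lemma gen_mul_coef {i j : ZMod 2} {a : SFun W} {m : PiT W} (ha : a.HasParity i)
    (hm : PiT.HasParity j m) : (gen W) m * (coef W) a = sgn i j * ((coef W) a * (gen W) m) := by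
  have := SymAlg.mk_rel (SymRel.coef_comm i j a m ha hm)
  simp only [map_mul, map_intCast] at this
  exact this

lemma gen_mul_gen {i j : ZMod 2} {m n : PiT W} (hm : PiT.HasParity i m)
    (hn : PiT.HasParity j n) :
    (gen W) m * (gen W) n = sgn i j * ((gen W) n * (gen W) m) := by
  have := SymAlg.mk_rel (pR := SFun.HasParity (W := W)) (SymRel.comm i j m n hm hn)
  simp only [map_mul, map_intCast] at this
  exact this

lemma hasParity_even : PiT.HasParity (W := W) 0 (1, 0) :=
  ⟨hasParity_one, hasParity_zero _⟩

lemma hasParity_odd : PiT.HasParity (W := W) 1 (0, 1) :=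
  ⟨hasParity_zero _, hasParity_one⟩

/-- The commutation relations are imposed only on homogeneous elements, so a general coefficient has
to be split before it can be moved past a generator. -/
lemma exists_decomp (a : SFun W) :
    ∃ b c : SFun W, b.HasParity 0 ∧ c.HasParity 1 ∧ a = b + c ∧ a.inv = b - c := by
  refine ⟨mk a.fst 0, mk 0 a.snd, by simp [hasParity_zero_iff], by simp [hasParity_one_iff],
    ext_comp (by simp) (by simp), ?_⟩
  rw [sub_eq_add_neg]
  exact ext_comp (by simp) (by simp)

lemma even_mul_coef (a : SFun W) :
    (gen W) (1, 0) * (coef W) a = (coef W) a * (gen W) (1, 0) := by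
  obtain ⟨b, c, hb, hc, rfl, -⟩ := exists_decomp a
  rw [map_add, mul_add, gen_mul_coef hb hasParity_even, gen_mul_coef hc hasParity_even, add_mul]
  simp [sgn]

lemma odd_mul_coef (a : SFun W) :
    (gen W) (0, 1) * (coef W) a = (coef W) a.inv * (gen W) (0, 1) := by
  obtain ⟨b, c, hb, hc, rfl, h⟩ := exists_decomp a
  rw [h, map_add, mul_add, gen_mul_coef hb hasParity_odd, gen_mul_coef hc hasParity_odd, map_sub,
    sub_mul]
  have s01 : sgn 0 1 = 1 := rfl
  have s11 : sgn 1 1 = -1 := rfl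
  simp [s01, s11, sub_eq_add_neg]

/-- The Koszul relation makes the square equal to its own negative; it vanishes because 2 is
invertible in ℂ. -/
lemma odd_mul_odd : (gen W) (0, 1) * (gen W) (0, 1) = 0 := by
  have h := gen_mul_gen (W := W) hasParity_odd hasParity_odd
  have s11 : sgn 1 1 = -1 := rfl
  rw [s11, Int.cast_neg, Int.cast_one, neg_one_mul] at h
  have h2 : (2 : ℂ) • ((gen W) (0, 1) * (gen W) (0, 1)) = 0 := by
    rw [two_smul]
    nth_rewrite 1 [h]
    exact neg_add_cancel _
  exact (smul_eq_zero_iff_right two_ne_zero).1 h2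

lemma even_mul_odd : (gen W) (1, 0) * (gen W) (0, 1) = (gen W) (0, 1) * (gen W) (1, 0) := by
  rw [gen_mul_gen hasParity_even hasParity_odd]
  simp [sgn]

lemma gen_eq (m : PiT W) :
    (gen W) m = (coef W) m.1 * (gen W) (1, 0) + (coef W) m.2 * (gen W) (0, 1) := by
  rw [← SymAlg.smul_def, ← SymAlg.smul_def, ← map_smul, ← map_smul, ← map_add]
  simp

lemma coe_smul_symEven (n : ℕ) (a : SFun W) :
    ((a • symEven W n : SymT n W) : SymAlg SFun.HasParity PiT.HasParity) =
      (coef W) a * (gen W) (1, 0) ^ n := rfl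

lemma coe_smul_symOdd (n : ℕ) (a : SFun W) :
    ((a • symOdd W (n + 1) : SymT (n + 1) W) : SymAlg SFun.HasParity PiT.HasParity) =
      (coef W) a * ((gen W) (0, 1) * (gen W) (1, 0) ^ n) := rfl

/-- Moving π∂_z past the coefficient F costs the parity involution, while π∂_θ is even and commutes
with F. This and `gen_mul_combination` are the inductive steps of the normal form. -/
lemma gen_mul_coef_mul_even_pow (m : PiT W) (n : ℕ) (F : SFun W) :
    (gen W) m * ((coef W) F * (gen W) (1, 0) ^ n) =
      (coef W) (m.1 * F) * (gen W) (1, 0) ^ (n + 1) +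
        (coef W) (m.2 * F.inv) * ((gen W) (0, 1) * (gen W) (1, 0) ^ n) := by
  have h1 : (gen W) (1, 0) * ((coef W) F * (gen W) (1, 0) ^ n) =
      (coef W) F * (gen W) (1, 0) ^ (n + 1) := by
    rw [← mul_assoc, even_mul_coef, mul_assoc, ← pow_succ']
  have h3 : (gen W) (0, 1) * ((coef W) F * (gen W) (1, 0) ^ n) =
      (coef W) F.inv * ((gen W) (0, 1) * (gen W) (1, 0) ^ n) := by
    rw [← mul_assoc, odd_mul_coef, mul_assoc]
  rw [gen_eq, add_mul, mul_assoc, mul_assoc, h1, h3, map_mul, map_mul, mul_assoc, mul_assoc]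

lemma gen_mul_combination (m : PiT W) (n : ℕ) (F G : SFun W) :
    (gen W) m * ((coef W) F * (gen W) (1, 0) ^ (n + 1) +
        (coef W) G * ((gen W) (0, 1) * (gen W) (1, 0) ^ n)) =
      (coef W) (m.1 * F) * (gen W) (1, 0) ^ (n + 2) +
        (coef W) (m.1 * G + m.2 * F.inv) * ((gen W) (0, 1) * (gen W) (1, 0) ^ (n + 1)) := by
  have h2 : (gen W) (1, 0) * ((coef W) G * ((gen W) (0, 1) * (gen W) (1, 0) ^ n)) =
      (coef W) G * ((gen W) (0, 1) * (gen W) (1, 0) ^ (n + 1)) := by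
    rw [← mul_assoc, even_mul_coef, mul_assoc, ← mul_assoc ((gen W) (1, 0)), even_mul_odd,
      mul_assoc, ← pow_succ']
  have h4 : (gen W) (0, 1) * ((coef W) G * ((gen W) (0, 1) * (gen W) (1, 0) ^ n)) = 0 := by
    rw [← mul_assoc, odd_mul_coef, mul_assoc, ← mul_assoc ((gen W) (0, 1)), odd_mul_odd, zero_mul,
      mul_zero]
  rw [mul_add, gen_mul_coef_mul_even_pow, gen_eq m, add_mul, mul_assoc _ _ ((coef W) G * _),
    mul_assoc _ _ ((coef W) G * _), h2, h4]
  simp only [map_add, map_mul, mul_assoc, add_mul, mul_zero, add_zero]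
  abel

/-- Induction on the number of factors: multiplying a normal form on the left by a generator gives a
normal form again. -/
lemma exists_combination_prod (n : ℕ) (m : Fin n → PiT W) :
    ∃ F G : SFun W, (List.ofFn fun i => (gen W) (m i)).prod =
      ((F • symEven W n + G • symOdd W n : SymT n W) : SymAlg SFun.HasParity PiT.HasParity) := by
  induction n with
  | zero => exact ⟨1, 0, by simp [symEven]⟩
  | succ n ih =>
    obtain ⟨F, G, h⟩ := ih fun i => m i.succ
    rw [List.ofFn_succ, List.prod_cons, h]
    -- For an empty tail there is no odd generator yet; the first factor creates it from F alone,
    -- and the value of G is irrelevant.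
    rcases n with _ | n
    · refine ⟨(m 0).1 * F, (m 0).2 * F.inv, ?_⟩
      rw [Submodule.coe_add, Submodule.coe_add, coe_smul_symEven, coe_smul_symEven,
        coe_smul_symOdd, show symOdd W 0 = 0 from rfl, smul_zero, Submodule.coe_zero, add_zero]
      exact gen_mul_coef_mul_even_pow _ _ _
    · refine ⟨(m 0).1 * F, (m 0).1 * G + (m 0).2 * F.inv, ?_⟩
      rw [Submodule.coe_add, Submodule.coe_add, coe_smul_symEven, coe_smul_symEven,
        coe_smul_symOdd, coe_smul_symOdd]
      exact gen_mul_combination _ _ _ _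

lemma exists_combination {n : ℕ} (x : SymT n W) :
    ∃ F G : SFun W, x = F • symEven W n + G • symOdd W n := by
  obtain ⟨x, hx⟩ := x
  simp only [Subtype.ext_iff]
  refine Submodule.span_induction ?_ ?_ ?_ ?_ hx
  · rintro _ ⟨m, rfl⟩
    exact exists_combination_prod n m
  · exact ⟨0, 0, by simp⟩
  · rintro x y - - ⟨F, G, rfl⟩ ⟨F', G', rfl⟩
    exact ⟨F + F', G + G', by rw [← Submodule.coe_add]; congr 1; module⟩
  · rintro a x - ⟨F, G, rfl⟩
    exact ⟨a * F, a * G, by rw [← Submodule.coe_smul]; congr 1; module⟩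

end SymT

/-! ### The local frame of `Ber ⊗ Sym^n ΠT` -/

namespace BerSym

open SFun

variable {W W' : Opens ℂ}

/-- The components of a section of `Ber ⊗ Sym^n ΠT`. -/
def comps (n : ℕ) (W : Opens ℂ) : (BerSym n).obj W →ₗ[SFun W] SFun W × SFun W :=
  (SymT.comps W ∘ₗ (SymT n W).subtype) ∘ₗ (TensorProduct.lid (SFun W) (SymT n W)).toLinearMap

/-- The section of `Ber ⊗ Sym^n ΠT` with given components. -/
def ofComps (n : ℕ) (W : Opens ℂ) : SFun W × SFun W →ₗ[SFun W] (BerSym n).obj W :=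
  (TensorProduct.lid (SFun W) (SymT n W)).symm.toLinearMap ∘ₗ
    (LinearMap.toSpanSingleton (SFun W) _ (symEven W n)).coprod
      (LinearMap.toSpanSingleton (SFun W) _ (symOdd W n))

lemma ofComps_apply (n : ℕ) (c : SFun W × SFun W) : ofComps n W c = berSym n c.1 c.2 := rfl

lemma comps_tmul (n : ℕ) (x : SymT n W) :
    comps n W ((1 : SFun W) ⊗ₜ[SFun W] x) = SymT.comps W x :=
  congrArg (fun y : SymT n W => SymT.comps W y) ((TensorProduct.lid_tmul x 1).trans (one_smul _ x))

lemma comps_berSym_succ (n : ℕ) (F G : SFun W) :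
    comps (n + 1) W (berSym (n + 1) F G) = (F, G) := by
  rw [berSym, comps_tmul, Submodule.coe_add, Submodule.coe_smul, Submodule.coe_smul, map_add,
    map_smul, map_smul, SymT.comps_symEven, SymT.comps_symOdd]
  simp

lemma comps_berSym_zero (F G : SFun W) : comps 0 W (berSym 0 F G) = (F, 0) := by
  rw [berSym, comps_tmul, Submodule.coe_add, Submodule.coe_smul, Submodule.coe_smul, map_add,
    map_smul, map_smul, SymT.comps_symEven, show symOdd W 0 = 0 from rfl, Submodule.coe_zero,
    map_zero]
  simp

lemma exists_berSym {n : ℕ} (x : (BerSym n).obj W) : ∃ F G : SFun W, x = berSym n F G := by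
  obtain ⟨F, G, h⟩ := SymT.exists_combination (TensorProduct.lid (SFun W) (SymT n W) x)
  refine ⟨F, G, ?_⟩
  apply (TensorProduct.lid (SFun W) (SymT n W)).injective
  rw [h, berSym, TensorProduct.lid_tmul, one_smul]

lemma berSym_zero_right (F G : SFun W) : berSym 0 F G = berSym 0 F 0 := by
  simp only [berSym, symOdd, smul_zero]
  rfl

lemma berSym_comps {n : ℕ} (x : (BerSym n).obj W) :
    berSym n (comps n W x).1 (comps n W x).2 = x := by
  obtain ⟨F, G, rfl⟩ := exists_berSym x
  rcases n with _ | n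
  · rw [comps_berSym_zero, berSym_zero_right F G]
  · rw [comps_berSym_succ]

end BerSym

/-! ### Transition maps of Ber, ΠT and Ber ⊗ Sym^n ΠT in the local frames -/

variable {W W' : Opens ℂ}

open SFun

/-- The Berezinian and the rescaling rule for delta functions use the total function `Ring.inverse`;
its value is identified by exhibiting an inverse. -/
lemma ringInverse_eq {R : Type} [CommRing R] {a b : R} (h : a * b = 1) : Ring.inverse a = b := by
  have ha : IsUnit a := IsUnit.of_mul_eq_one b h
  rw [← mul_one (Ring.inverse a), ← h, Ring.inverse_mul_cancel_left _ _ ha]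

lemma SFun.HasParity.res {p : ZMod 2} {s : SFun W} (hs : s.HasParity p) (h : W' ≤ W) :
    (SFun.res h s).HasParity p :=
  hs.subst _ _

lemma diff_invθ (h : ∀ x ∈ W, x ≠ 0) : diff (invθ h) = (invZ h, θ W * invZ h ^ 2) := by
  refine Prod.ext (ext_comp ?_ ?_) (ext_comp ?_ ?_) <;>
    simp [diff, invθ, snd_pow_eq_zero]

lemma diff_invZ (h : ∀ x ∈ W, x ≠ 0) : diff (invZ h) = (0, -invZ h ^ 2) := by
  refine Prod.ext (ext_comp ?_ ?_) (ext_comp ?_ ?_) <;>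
    simp [diff, snd_pow_eq_zero]

lemma inverse_invZ (h : ∀ x ∈ W, x ≠ 0) : Ring.inverse (invZ h) = z W :=
  ringInverse_eq (by rw [mul_comm, z_mul_invZ])

/-- The function 1/z does not involve θ, so the matrix is triangular and the Berezinian is the
quotient of its diagonal entries z⁻¹ and -z⁻². -/
lemma jacBer_eq (h : Overlap W W') : jacBer h = -z W' := by
  have h1 := z_mul_invZ h.ne'
  have h2 : Ring.inverse (-invZ h.ne' ^ 2) = -z W' ^ 2 := by
    apply ringInverse_eq
    linear_combination (z W' * invZ h.ne' + 1) * h1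
  rw [jacBer, berezinian, diff_invθ, diff_invZ, h2]
  linear_combination -z W' * h1

lemma inverse_jacBer (h : Overlap W W') : Ring.inverse (jacBer h) = -invZ h.ne' := by
  apply ringInverse_eq
  rw [jacBer_eq, neg_mul_neg, z_mul_invZ]

lemma Ber_tr_apply (h : Overlap W W') (f : SFun W) :
    Ber.tr h f = (-(invZ h.ne' * trans h f) : SFun W') := by
  change trans h f * Ring.inverse (jacBer h) = _
  rw [inverse_jacBer]
  ring

/-- The new components are the derivatives of θ₁₀/z₁₀ and 1/z₁₀ along ∂_{θ₁₀}, rewritten through z₁₀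
= 1/z₀₁. -/
lemma PiT.trans_even (h : Overlap W W') :
    PiT.trans h ((1, 0) : PiT W) = ((z W', 0) : PiT W') := by
  have h1 : PiT.app ((1, 0) : PiT W) (invθ h.ne) = invZ h.ne := by
    apply ext_comp <;> simp [PiT.app, invθ]
  have h2 : PiT.app ((1, 0) : PiT W) (invZ h.ne) = 0 := by
    apply ext_comp <;> simp [PiT.app]
  change (SuperP1.trans h _, SuperP1.trans h _) = _
  rw [h1, h2, trans_invZ, map_zero]

lemma PiT.trans_odd (h : Overlap W W') :
    PiT.trans h ((0, 1) : PiT W) = ((-(θ W' * z W'), -z W' ^ 2) : PiT W') := by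
  have h1 : PiT.app ((0, 1) : PiT W) (invθ h.ne) = -(θ W * invZ h.ne ^ 2) := by
    apply ext_comp <;> simp [PiT.app, invθ, snd_pow_eq_zero]
  have h2 : PiT.app ((0, 1) : PiT W) (invZ h.ne) = -invZ h.ne ^ 2 := by
    apply ext_comp <;> simp [PiT.app, snd_pow_eq_zero]
  have h3 := z_mul_invZ h.ne'
  change (SuperP1.trans h _, SuperP1.trans h _) = _
  rw [h1, h2, map_neg, map_neg, map_mul, map_pow, trans_invZ, trans_θ]
  refine Prod.ext ?_ rfl
  linear_combination -(θ W' * z W') * h3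

namespace SymT

/-- Restriction of sections of `Sym^n ΠT`. -/
abbrev res (n : ℕ) (h : W' ≤ W) : SymT n W →ₛₗ[(SFun.res h : SFun W →+* SFun W')] SymT n W' :=
  SymPow.map (SFun.res h) (PiT.res h) (fun _ _ hs => hs.res h) (PiT.hasParity_res h) n

/-- The transition map of `Sym^n ΠT`. -/
abbrev tr (n : ℕ) (h : Overlap W W') :
    SymT n W →ₛₗ[(SuperP1.trans h : SFun W →+* SFun W')] SymT n W' :=
  SymPow.map (SuperP1.trans h) (PiT.trans h) (fun _ _ hs => hs.trans h) (PiT.hasParity_trans h) n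

lemma coe_symEven (n : ℕ) : (symEven W n).1 =
    SymAlg.gen SFun.HasParity PiT.HasParity ((1, 0) : PiT W) ^ n := rfl

lemma coe_symOdd (n : ℕ) : (symOdd W (n + 1)).1 =
    SymAlg.gen SFun.HasParity PiT.HasParity ((0, 1) : PiT W) *
      SymAlg.gen SFun.HasParity PiT.HasParity ((1, 0) : PiT W) ^ n := rfl

lemma res_symEven (n : ℕ) (h : W' ≤ W) : res n h (symEven W n) = symEven W' n := by
  ext1
  change SymAlg.map _ _ _ _ (SymAlg.gen _ _ _ ^ n) = _
  rw [map_pow, SymAlg.map_gen, coe_symEven]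
  congr 2
  exact Prod.ext (map_one (SFun.res h)) (map_zero (SFun.res h))

lemma res_symOdd (n : ℕ) (h : W' ≤ W) : res n h (symOdd W n) = symOdd W' n := by
  rcases n with _ | n
  · exact map_zero _
  ext1
  change SymAlg.map _ _ _ _ (SymAlg.gen _ _ _ * SymAlg.gen _ _ _ ^ n) = _
  rw [map_mul, map_pow, SymAlg.map_gen, SymAlg.map_gen, coe_symOdd]
  congr 3
  · exact Prod.ext (map_zero (SFun.res h)) (map_one (SFun.res h))
  · exact Prod.ext (map_one (SFun.res h)) (map_zero (SFun.res h))

lemma gen_smul_even_pow (n : ℕ) (a : SFun W) :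
    SymAlg.gen SFun.HasParity PiT.HasParity ((a, 0) : PiT W) ^ n =
      SymAlg.coef SFun.HasParity PiT.HasParity (a ^ n) *
        SymAlg.gen SFun.HasParity PiT.HasParity ((1, 0) : PiT W) ^ n := by
  have h : Commute (SymAlg.coef SFun.HasParity PiT.HasParity a)
      (SymAlg.gen SFun.HasParity PiT.HasParity ((1, 0) : PiT W)) := (even_mul_coef a).symm
  rw [gen_eq, map_zero, zero_mul, add_zero, h.mul_pow, map_pow]

lemma tr_symEven (n : ℕ) (h : Overlap W W') :
    tr n h (symEven W n) = z W' ^ n • symEven W' n := by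
  ext1
  change SymAlg.map _ _ _ _ (SymAlg.gen _ _ _ ^ n) = _
  rw [map_pow, SymAlg.map_gen, PiT.trans_even, gen_smul_even_pow, coe_smul_symEven]

lemma inv_z_pow (n : ℕ) : (z W ^ n).inv = z W ^ n := by
  apply ext_comp <;> simp

lemma tr_symOdd (n : ℕ) (h : Overlap W W') :
    tr (n + 1) h (symOdd W (n + 1)) =
      (-(θ W' * z W' ^ (n + 1))) • symEven W' (n + 1) + (-z W' ^ (n + 2)) • symOdd W' (n + 1) := by
  ext1
  change SymAlg.map _ _ _ _ (SymAlg.gen _ _ _ * SymAlg.gen _ _ _ ^ n) = _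
  rw [map_mul, map_pow, SymAlg.map_gen, SymAlg.map_gen, PiT.trans_even, PiT.trans_odd,
    gen_smul_even_pow, gen_mul_coef_mul_even_pow, inv_z_pow, Submodule.coe_add, coe_smul_symEven,
    coe_smul_symOdd]
  congr 3 <;> ring

end SymT

namespace BerSym

lemma res_berSym (n : ℕ) (h : W' ≤ W) (F G : SFun W) :
    (BerSym n).res h (berSym n F G) = berSym n (SFun.res h F) (SFun.res h G) := by
  refine (TensorProduct.map_tmul _ _ _ _).trans ?_
  have h1 : SymT.res n h (F • symEven W n + G • symOdd W n) =
      SFun.res h F • symEven W' n + SFun.res h G • symOdd W' n := by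
    rw [map_add, map_smulₛₗ, map_smulₛₗ, SymT.res_symEven, SymT.res_symOdd]
    rfl
  exact congrArg₂ (fun (a : SFun W') (b : SymT n W') => a ⊗ₜ[SFun W'] b) (map_one (SFun.res h)) h1

/-- The condition on G is needed because `symOdd W 0` is 0: for n = 0 the left side ignores G,
whereas the first component of `Comp.tr` does not. -/
lemma tr_berSym (n : ℕ) (h : Overlap W W') (F G : SFun W) (hG : n = 0 → G = 0) :
    (BerSym n).tr h (berSym n F G) =
      berSym n (Comp.tr n h (F, G)).1 (Comp.tr n h (F, G)).2 := by
  have h0 := z_mul_invZ h.ne'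
  -- The factor -z is split off so that it cancels the transition function -z⁻¹ of Ber after being
  -- moved across the tensor product.
  have h1 : SymT.tr n h (F • symEven W n + G • symOdd W n) = (-z W') •
      ((Comp.tr n h (F, G)).1 • symEven W' n + (Comp.tr n h (F, G)).2 • symOdd W' n) := by
    rw [map_add, map_smulₛₗ, map_smulₛₗ, SymT.tr_symEven]
    simp only [RingHom.coe_coe, Comp.tr]
    rcases n with _ | n
    · rw [hG rfl, map_zero, zero_smul, mul_zero, mul_zero, zero_smul, add_zero, add_zero, add_zero,
        smul_smul, smul_smul]
      congr 1
      linear_combination -SuperP1.trans h F * h0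
    · rw [SymT.tr_symOdd]
      simp only [smul_add, smul_smul]
      rw [← add_assoc, ← add_smul]
      congr 2
      · linear_combination (θ W' * SuperP1.trans h G - SuperP1.trans h F) * z W' ^ (n + 1) * h0
      · ring
  have h2 : Ber.tr h (1 : SFun W) = (-invZ h.ne' : SFun W') := by
    rw [Ber_tr_apply, map_one, mul_one]
  refine (TensorProduct.map_tmul _ _ _ _).trans ((congrArg₂
    (fun (a : SFun W') (b : SymT n W') => a ⊗ₜ[SFun W'] b) h2 h1).trans ?_)
  rw [← TensorProduct.smul_tmul, smul_eq_mul, neg_mul_neg, h0]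
  rfl

lemma comps_res (n : ℕ) (h : W' ≤ W) (x : (BerSym n).obj W) :
    comps n W' ((BerSym n).res h x) = Comp.res h (comps n W x) := by
  obtain ⟨F, G, rfl⟩ := exists_berSym x
  rw [res_berSym]
  rcases n with _ | n
  · rw [comps_berSym_zero, comps_berSym_zero, Comp.res, map_zero]
  · rw [comps_berSym_succ, comps_berSym_succ, Comp.res]

lemma comps_tr (n : ℕ) (h : Overlap W W') (x : (BerSym n).obj W) :
    comps n W' ((BerSym n).tr h x) = Comp.tr n h (comps n W x) := by
  obtain ⟨F, G, rfl⟩ := exists_berSym x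
  rcases n with _ | n
  · rw [berSym_zero_right, tr_berSym _ _ _ _ fun _ => rfl, comps_berSym_zero, comps_berSym_zero]
    exact Prod.ext rfl (Comp.tr_snd_eq_zero 0 h rfl).symm
  · rw [tr_berSym _ _ _ _ fun h => absurd h n.succ_ne_zero, comps_berSym_succ, comps_berSym_succ]

lemma berSym_mem_parity (n : ℕ) {p : ZMod 2} {F G : SFun W} (hF : F.HasParity p)
    (hG : G.HasParity (p + 1)) : berSym n F G ∈ BerSym.parity n W p := by
  refine ⟨F • symEven W n + G • symOdd W n, add_mem ?_ ?_, rfl⟩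
  · refine AddSubgroup.subset_closure ⟨p, F, fun _ => 0, fun _ => (1, 0), hF,
      fun _ => SymT.hasParity_even, by simp, ?_⟩
    rw [SymT.coe_smul_symEven, SymAlg.smul_def]
    simp
  · rcases n with _ | n
    · rw [show symOdd W 0 = 0 from rfl, smul_zero]
      exact zero_mem _
    -- The coefficient has parity p + 1 and exactly one factor, π∂_z, is odd; the total is p modulo
    -- 2.
    · refine AddSubgroup.subset_closure ⟨p + 1, G, Fin.cons 1 fun _ => 0,
        Fin.cons (0, 1) fun _ => (1, 0), hG, fun l => ?_, ?_, ?_⟩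
      · refine Fin.cases ?_ (fun _ => ?_) l
        · exact SymT.hasParity_odd
        · exact SymT.hasParity_even
      · rw [Fin.sum_univ_succ]
        simp only [Fin.cons_zero, Fin.cons_succ, Finset.sum_const_zero, add_zero]
        rw [add_assoc, show (1 : ZMod 2) + 1 = 0 from rfl, add_zero]
      · rw [SymT.coe_smul_symOdd, SymAlg.smul_def]
        simp [List.ofFn_succ]

end BerSym

/-! ### Integral forms in components -/

namespace Delta

lemma dθMul_smul_sym (f : SFun W) (a : Fin 2) (r : ℕ) :
    dθMul (f • sym W a r) = (-(r : SFun W) * f) • sym W a (r - 1) := by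
  rw [sym, Finsupp.smul_single, smul_eq_mul, mul_one, dθMul, Finsupp.sum_single_index]
  simp

lemma dzMul_smul_sym_zero (f : SFun W) (r : ℕ) : dzMul (f • sym W 0 r) = f.inv • sym W 1 r := by
  rw [sym, Finsupp.smul_single, smul_eq_mul, mul_one, dzMul, Finsupp.sum_single_index] <;> simp

lemma dzMul_smul_sym_one (f : SFun W) (r : ℕ) : dzMul (f • sym W 1 r) = 0 := by
  rw [sym, Finsupp.smul_single, smul_eq_mul, mul_one, dzMul, Finsupp.sum_single_index] <;> simp

lemma dzMul_add (s t : Delta W) : dzMul (s + t) = dzMul s + dzMul t := by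
  refine Finsupp.sum_add_index' (fun p => ?_) fun p f g => ?_
  · simp
  · split_ifs
    · rw [inv_add, add_smul]
    · rw [add_zero]

lemma d_add (s t : Delta W) : d (s + t) = d s + d t := by
  refine Finsupp.sum_add_index' (fun p => ?_) fun p f g => ?_
  · have h : diff (0 : SFun W) = 0 := by
      refine Prod.ext (ext_comp ?_ ?_) (ext_comp ?_ ?_) <;> simp [diff]
    simp [h, formMul]
  · have h : diff (f + g) = diff f + diff g := by
      refine Prod.ext (ext_comp ?_ ?_) (ext_comp ?_ ?_) <;> simp [diff, add_comm]
    simp only [h, formMul, Prod.fst_add, Prod.snd_add]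
    module

lemma d_smul_sym (f : SFun W) (a : Fin 2) (r : ℕ) :
    d (f • sym W a r) = formMul (diff f) (sym W a r) := by
  rw [sym, Finsupp.smul_single, smul_eq_mul, mul_one, d, Finsupp.sum_single_index]
  · rfl
  · have h : diff (0 : SFun W) = 0 := by
      refine Prod.ext (ext_comp ?_ ?_) (ext_comp ?_ ?_) <;> simp [diff]
    simp [h, formMul]

/-- The ∂_z f term carries dz dz = 0, so only dθ ∂_θ f survives, lowering the order of the delta
function by one. -/
lemma d_smul_sym_one (f : SFun W) (r : ℕ) :
    d (f • sym W 1 (r + 1)) = (-((r : SFun W) + 1) * f.dθ) • sym W 1 r := by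
  have h1 := dθMul_smul_sym (1 : SFun W) 1 (r + 1)
  have h2 := dzMul_smul_sym_one (1 : SFun W) (r + 1)
  rw [one_smul] at h1 h2
  rw [d_smul_sym, formMul, h1, h2, diff, smul_zero, add_zero, smul_smul]
  congr 1
  push_cast
  ring

lemma d_smul_sym_zero (f : SFun W) (r : ℕ) :
    d (f • sym W 0 r) = (-(r : SFun W) * f.dθ) • sym W 0 (r - 1) + f.dz.inv • sym W 1 r := by
  have h1 := dθMul_smul_sym (1 : SFun W) 0 r
  have h2 := dzMul_smul_sym_zero (1 : SFun W) r
  rw [one_smul] at h1 h2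
  rw [d_smul_sym, formMul, h1, h2, diff, smul_smul, inv_one, one_smul]
  congr 2
  ring

/-- Here u = 1/z and v = θ/z², so the rescaling factor is z^{r+1} and the Taylor coefficient u⁻¹v is
θ/z. -/
lemma deltaOf_diff_invθ (r : ℕ) (h : ∀ x ∈ W, x ≠ 0) :
    deltaOf r (diff (invθ h)) =
      z W ^ (r + 1) • sym W 0 r + (θ W * z W ^ r) • sym W 1 (r + 1) := by
  have h2 := dzMul_smul_sym_zero (1 : SFun W) (r + 1)
  rw [one_smul, inv_one, one_smul] at h2
  rw [deltaOf, diff_invθ, inverse_invZ, formMul, h2, zero_smul, zero_add, smul_add, smul_smul]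
  congr 2
  have h1 : z W ^ (r + 1) * (z W * (θ W * invZ h ^ 2)) = θ W * z W ^ r * (z W * invZ h) ^ 2 := by
    ring
  rw [h1, z_mul_invZ, one_pow, mul_one]

lemma tr_smul_sym (h : Overlap W W') (f : SFun W) (a : Fin 2) (r : ℕ) :
    Delta.tr h (f • sym W a r) = trans h f • symTrans h (a, r) := by
  rw [sym, Finsupp.smul_single, smul_eq_mul, mul_one]
  change Finsupp.linearCombination (SFun W') (symTrans h)
    (Finsupp.mapRange (trans h) (map_zero _) (Finsupp.single (a, r) f)) = _
  rw [Finsupp.mapRange_single, Finsupp.linearCombination_single]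

lemma symTrans_zero (h : Overlap W W') (r : ℕ) :
    symTrans h (0, r) = z W' ^ (r + 1) • sym W' 0 r + (θ W' * z W' ^ r) • sym W' 1 (r + 1) := by
  rw [symTrans, if_pos rfl, deltaOf_diff_invθ]

/-- Multiplication by dz kills the Taylor term, and -z⁻² from dz₁₀ meets z^{r+1} from the rescaling.
-/
lemma symTrans_one (h : Overlap W W') (r : ℕ) :
    symTrans h (1, r) = (-(z W' ^ r * invZ h.ne')) • sym W' 1 r := by
  rw [symTrans, if_neg one_ne_zero, deltaOf_diff_invθ, diff_invZ, formMul, zero_smul, zero_add,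
    dzMul_add, dzMul_smul_sym_zero, dzMul_smul_sym_one, SymT.inv_z_pow, add_zero, smul_smul]
  congr 1
  linear_combination -(z W' ^ r * invZ h.ne') * z_mul_invZ h.ne'

/-- The components of an integral form of degree `1 - n`. -/
def comps (n : ℕ) (W : Opens ℂ) : Delta W →ₗ[SFun W] SFun W × SFun W :=
  (Finsupp.lapply (1, n)).prod (Finsupp.lapply (0, n - 1))

lemma comps_apply (n : ℕ) (s : Delta W) : comps n W s = (s.coeff 1 n, s.coeff 0 (n - 1)) := rfl

/-- The integral form of degree `1 - n` with given components. -/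
def ofComps : (n : ℕ) → (W : Opens ℂ) → SFun W × SFun W →ₗ[SFun W] Delta W
  | 0, W => LinearMap.toSpanSingleton (SFun W) _ (sym W 1 0) ∘ₗ LinearMap.fst _ _ _
  | n + 1, W => (LinearMap.toSpanSingleton (SFun W) _ (sym W 1 (n + 1))).coprod
      (LinearMap.toSpanSingleton (SFun W) _ (sym W 0 n))

lemma ofComps_zero (c : SFun W × SFun W) : ofComps 0 W c = c.1 • sym W 1 0 := rfl

lemma ofComps_succ (n : ℕ) (c : SFun W × SFun W) :
    ofComps (n + 1) W c = c.1 • sym W 1 (n + 1) + c.2 • sym W 0 n := rfl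

lemma coeff_add (s t : Delta W) (a : Fin 2) (r : ℕ) :
    (s + t).coeff a r = s.coeff a r + t.coeff a r := rfl

lemma coeff_smul_sym (f : SFun W) (a b : Fin 2) (r m : ℕ) :
    (f • sym W a r).coeff b m = if a = b ∧ r = m then f else 0 := by
  rw [sym, Finsupp.smul_single, smul_eq_mul, mul_one, coeff, Finsupp.single_apply]
  simp only [Prod.mk.injEq]

lemma ext_coeff {s t : Delta W} (h : ∀ a r, s.coeff a r = t.coeff a r) : s = t :=
  Finsupp.ext fun p => h p.1 p.2

lemma hasDegree_ofComps (n : ℕ) (c : SFun W × SFun W) :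
    HasDegree (1 - (n : ℤ)) (ofComps n W c) := by
  intro a r h
  rcases n with _ | n
  · rw [ofComps_zero, coeff_smul_sym, if_neg]
    rintro ⟨rfl, rfl⟩
    simp at h
  · rw [ofComps_succ, coeff_add, coeff_smul_sym, coeff_smul_sym, if_neg, if_neg, add_zero]
    · rintro ⟨rfl, rfl⟩
      simp at h
    · rintro ⟨rfl, rfl⟩
      simp at h

/-- For n = 0 the truncated index n - 1 is 0, so the second component reads the coefficient of
δ^{(0)}(dθ). That symbol has degree 0, not 1, and does not occur. -/
lemma comps_snd_eq_zero {s : Delta W} (hs : HasDegree (1 - ((0 : ℕ) : ℤ)) s) :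
    (comps 0 W s).2 = 0 :=
  hs 0 0 (by simp)

lemma ofComps_comps {n : ℕ} {s : Delta W} (hs : HasDegree (1 - (n : ℤ)) s) :
    ofComps n W (comps n W s) = s := by
  refine ext_coeff fun a r => ?_
  by_cases h : (a.val : ℤ) - r = 1 - n
  · rcases n with _ | n
    · rw [ofComps_zero, coeff_smul_sym, comps_apply]
      fin_cases a
      · simp at h
        omega
      · obtain rfl : r = 0 := by simp at h; omega
        simp
    · rw [ofComps_succ, coeff_add, coeff_smul_sym, coeff_smul_sym, comps_apply]
      fin_cases a
      · obtain rfl : r = n := by simp at h; omega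
        simp
      · obtain rfl : r = n + 1 := by simp at h; omega
        simp
  · rw [hs a r h, hasDegree_ofComps n _ a r h]

lemma comps_ofComps {n : ℕ} {c : SFun W × SFun W} (hc : n = 0 → c.2 = 0) :
    comps n W (ofComps n W c) = c := by
  rcases n with _ | n
  · rw [ofComps_zero, comps_apply, coeff_smul_sym, coeff_smul_sym]
    refine Prod.ext ?_ ?_ <;> simp [hc rfl]
  · rw [ofComps_succ, comps_apply, coeff_add, coeff_add, coeff_smul_sym, coeff_smul_sym,
      coeff_smul_sym, coeff_smul_sym]
    refine Prod.ext ?_ ?_ <;> simp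

/-- Restriction of integral forms. -/
abbrev res (h : W' ≤ W) : Delta W →ₛₗ[(SFun.res h : SFun W →+* SFun W')] Delta W' :=
  Finsupp.mapRange.linearMap (RingHomClass.toRingHom (SFun.res h)).toSemilinearMap

lemma coeff_res (h : W' ≤ W) (s : Delta W) (a : Fin 2) (r : ℕ) :
    coeff (Delta.res h s) a r = SFun.res h (s.coeff a r) := by
  exact Finsupp.mapRange_apply (hf := map_zero (SFun.res h))

lemma comps_res (n : ℕ) (h : W' ≤ W) (s : Delta W) :
    comps n W' (Delta.res h s) = Comp.res h (comps n W s) := by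
  rw [comps_apply, comps_apply, coeff_res, coeff_res, Comp.res]

lemma hasDegree_res {k : ℤ} (h : W' ≤ W) {s : Delta W} (hs : HasDegree k s) :
    HasDegree (W := W') k (Delta.res h s) := by
  intro a r har
  rw [coeff_res, hs a r har, map_zero]

lemma tr_ofComps (n : ℕ) (h : Overlap W W') {c : SFun W × SFun W} (hc : n = 0 → c.2 = 0) :
    Delta.tr h (ofComps n W c) = ofComps n W' (Comp.tr n h c) := by
  rcases n with _ | n
  · rw [ofComps_zero, ofComps_zero, tr_smul_sym, symTrans_one, Comp.tr, hc rfl]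
    refine (smul_smul _ _ _).trans ?_
    congr 1
    rw [map_zero]
    ring
  · rw [ofComps_succ, ofComps_succ, map_add, tr_smul_sym, tr_smul_sym, symTrans_one, symTrans_zero,
      Comp.tr]
    have h1 : θ W' * (z W' ^ (n + 1) * invZ h.ne') * trans h c.2 =
        trans h c.2 * (θ W' * z W' ^ n) := by
      linear_combination θ W' * z W' ^ n * trans h c.2 * z_mul_invZ h.ne'
    rw [h1]
    module

lemma comps_tr (n : ℕ) (h : Overlap W W') {s : Delta W} (hs : HasDegree (1 - (n : ℤ)) s) :
    comps n W' (Delta.tr h s) = Comp.tr n h (comps n W s) := by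
  have h0 : n = 0 → (comps n W s).2 = 0 := by
    rintro rfl
    exact comps_snd_eq_zero hs
  conv_lhs => rw [← ofComps_comps hs]
  rw [tr_ofComps n h h0, comps_ofComps fun hn => Comp.tr_snd_eq_zero n h (h0 hn)]

lemma hasDegree_tr (n : ℕ) (h : Overlap W W') {s : Delta W} (hs : HasDegree (1 - (n : ℤ)) s) :
    HasDegree (W := W') (1 - (n : ℤ)) (Delta.tr h s) := by
  rw [← ofComps_comps hs, tr_ofComps n h]
  · exact hasDegree_ofComps n _
  · rintro rfl
    exact comps_snd_eq_zero hs

lemma d_ofComps (n : ℕ) (c : SFun W × SFun W) :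
    d (ofComps (n + 1) W c) = ofComps n W (Comp.d n c) := by
  rw [ofComps_succ, d_add, d_smul_sym_one, d_smul_sym_zero]
  -- For n = 0 the contraction of dθ with δ^{(0)}(dθ) has coefficient 0, so the symbol with the
  -- truncated index n - 1 disappears.
  rcases n with _ | n
  · rw [ofComps_zero, Comp.d]
    simp only [Nat.cast_zero, neg_zero, zero_mul, zero_smul]
    module
  · rw [ofComps_succ, Comp.d]
    simp only [Nat.add_sub_cancel]
    module

lemma hasParity_ofComps (n : ℕ) {p : ZMod 2} {c : SFun W × SFun W} (h₁ : c.1.HasParity p)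
    (h₂ : c.2.HasParity (p + 1)) : HasParity p (ofComps n W c) := by
  have h11 : p + ((1 : Fin 2).val : ZMod 2) + 1 = p := by
    rw [add_assoc]
    exact add_zero p
  have h12 : p + ((0 : Fin 2).val : ZMod 2) + 1 = p + 1 := by simp
  have key : ∀ (f : SFun W) (b : Fin 2) (m : ℕ), f.HasParity (p + (b.val : ZMod 2) + 1) →
      HasParity p (f • sym W b m) := by
    intro f b m hf a r
    rw [coeff_smul_sym]
    split_ifs with h
    · rwa [← h.1]
    · exact hasParity_zero _
  rcases n with _ | n
  · rw [ofComps_zero]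
    exact key _ _ _ (by rwa [h11])
  · rw [ofComps_succ]
    intro a r
    exact (key _ 1 _ (by rwa [h11]) a r).add (key _ 0 _ (by rwa [h12]) a r)

lemma HasParity.comps (n : ℕ) {p : ZMod 2} {s : Delta W} (hs : HasParity p s) :
    (comps n W s).1.HasParity p ∧ (Delta.comps n W s).2.HasParity (p + 1) := by
  have h11 : p + ((1 : Fin 2).val : ZMod 2) + 1 = p := by
    rw [add_assoc]
    exact add_zero p
  have h12 : p + ((0 : Fin 2).val : ZMod 2) + 1 = p + 1 := by simp
  have h1 := hs 1 n
  have h2 := hs 0 (n - 1)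
  rw [h11] at h1
  rw [h12] at h2
  exact ⟨h1, h2⟩

end Delta

/-! ### Sections over a chart -/

/-- Restriction and transition maps for a family of objects on open subsets of `ℂ`, with mutually
inverse transition maps. -/
structure ChartMaps (A : Opens ℂ → Type) where
  res : ∀ {W W' : Opens ℂ}, W' ≤ W → A W → A W'
  tr : ∀ {W W' : Opens ℂ}, Overlap W W' → A W → A W'
  res_self : ∀ {W : Opens ℂ} (h : W ≤ W) (a : A W), res h a = a
  res_res : ∀ {W W' W'' : Opens ℂ} (h : W' ≤ W) (h' : W'' ≤ W') (a : A W),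
    res h' (res h a) = res (h'.trans h) a
  tr_tr : ∀ {W W' : Opens ℂ} (h : Overlap W W') (h' : Overlap W' W) (a : A W), tr h' (tr h a) = a

lemma overlap_symm (V : Opens (OnePoint ℂ)) : Overlap (ov 1 V) (ov 0 V) where
  ne _ hx := hx.2
  ne' _ hx := hx.2
  inv_mem w hw := by
    have h0 : w ≠ 0 := hw.2
    refine ⟨?_, inv_ne_zero h0⟩
    have h1 : pt 0 w ∈ V := hw.1
    change pt 1 w⁻¹ ∈ V
    simpa [pt, h0] using h1

/-- The only point of chart 1 outside the overlap has coordinate 0; it is the point at infinity,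
which chart 0 misses. -/
lemma loc_one_le_ov {V : Opens (OnePoint ℂ)} (hV : (V : Set (OnePoint ℂ)) ⊆ Set.range (pt 0)) :
    loc 1 V ≤ ov 1 V := by
  refine fun w hw => ⟨hw, ?_⟩
  rintro rfl
  obtain ⟨x, hx⟩ := hV hw
  simp [pt] at hx

lemma loc_zero_le_ov {V : Opens (OnePoint ℂ)} (hV : (V : Set (OnePoint ℂ)) ⊆ Set.range (pt 1)) :
    loc 0 V ≤ ov 0 V := by
  refine fun w hw => ⟨hw, ?_⟩
  rintro rfl
  obtain ⟨x, hx⟩ := hV hw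
  by_cases h0 : x = 0
  · simp [pt, h0] at hx
  · simp [pt, h0] at hx

/-- The pair of two sections. -/
def pair {A : Opens ℂ → Type} {V : Opens (OnePoint ℂ)} (a : A (loc 0 V)) (b : A (loc 1 V)) :
    ∀ j : Fin 2, A (loc j V)
  | 0 => a
  | 1 => b

namespace ChartMaps

variable {A : Opens ℂ → Type} (M : ChartMaps A) {V : Opens (OnePoint ℂ)}

/-- The two sections of a pair correspond to each other under the transition map. -/
def Compat (c : ∀ j : Fin 2, A (loc j V)) : Prop :=
  M.tr (overlap V) (M.res (ov_le 0 V) (c 0)) = M.res (ov_le 1 V) (c 1)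

variable {M}

/-- When V lies in the chart i, its part in the other chart lies in the overlap, where the
transition map and its inverse determine either section from the other. -/
lemma Compat.ext {i : Fin 2} (hV : (V : Set (OnePoint ℂ)) ⊆ Set.range (pt i))
    {c c' : ∀ j : Fin 2, A (loc j V)} (hc : M.Compat c) (hc' : M.Compat c') (h : c i = c' i) :
    c = c' := by
  have hi : ∀ i : Fin 2, i = 0 ∨ i = 1 := by decide
  have h01 : c 0 = c' 0 ∧ c 1 = c' 1 := by
    rcases hi i with rfl | rfl
    · refine ⟨h, ?_⟩
      have h1 : M.res (ov_le 1 V) (c 1) = M.res (ov_le 1 V) (c' 1) := by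
        rw [← hc, ← hc', h]
      have h2 := congrArg (M.res (loc_one_le_ov hV)) h1
      rwa [M.res_res, M.res_res, M.res_self, M.res_self] at h2
    · refine ⟨?_, h⟩
      have h1 : M.res (ov_le 0 V) (c 0) = M.res (ov_le 0 V) (c' 0) := by
        have h2 : M.tr (overlap V) (M.res (ov_le 0 V) (c 0)) =
            M.tr (overlap V) (M.res (ov_le 0 V) (c' 0)) := by
          rw [hc, hc', h]
        have h3 := congrArg (M.tr (overlap_symm V)) h2
        rwa [M.tr_tr, M.tr_tr] at h3
      have h2 := congrArg (M.res (loc_zero_le_ov hV)) h1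
      rwa [M.res_res, M.res_res, M.res_self, M.res_self] at h2
  funext j
  rcases hi j with rfl | rfl
  exacts [h01.1, h01.2]

variable (M)

/-- Existence counterpart of `Compat.ext`: the other section is the image under the transition map
or its inverse. The property Q carries along parity and the vanishing of the second component. -/
lemma exists_compat {i : Fin 2} (hV : (V : Set (OnePoint ℂ)) ⊆ Set.range (pt i))
    (Q : ∀ {W : Opens ℂ}, A W → Prop)
    (hres : ∀ {W W' : Opens ℂ} (h : W' ≤ W) (a : A W), Q a → Q (M.res h a))
    (htr : ∀ {W W' : Opens ℂ} (h : Overlap W W') (a : A W), Q a → Q (M.tr h a))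
    (a : A (loc i V)) (ha : Q a) :
    ∃ c : ∀ j : Fin 2, A (loc j V), M.Compat c ∧ c i = a ∧ ∀ j, Q (c j) := by
  have hi : ∀ i : Fin 2, i = 0 ∨ i = 1 := by decide
  rcases hi i with rfl | rfl
  · refine ⟨pair a (M.res (loc_one_le_ov hV) (M.tr (overlap V) (M.res (ov_le 0 V) a))), ?_, rfl,
      fun j => ?_⟩
    · change M.tr _ (M.res _ a) = M.res _ (M.res _ _)
      rw [M.res_res, M.res_self]
    · rcases hi j with rfl | rfl
      exacts [ha, hres _ _ (htr _ _ (hres _ _ ha))]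
  · refine ⟨pair (M.res (loc_zero_le_ov hV) (M.tr (overlap_symm V) (M.res (ov_le 1 V) a))) a, ?_,
      rfl, fun j => ?_⟩
    · change M.tr _ (M.res _ (M.res _ _)) = M.res _ a
      rw [M.res_res, M.res_self, M.tr_tr]
    · rcases hi j with rfl | rfl
      exacts [hres _ _ (htr _ _ (hres _ _ ha)), ha]

end ChartMaps

/-- The structure sheaf in the charts. -/
def SFun.chartMaps : ChartMaps SFun where
  res h := SFun.res h
  tr h := trans h
  res_self := SFun.res_self
  res_res := SFun.res_res
  tr_tr := SFun.trans_trans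

/-- Components in the charts. -/
def Comp.chartMaps (n : ℕ) : ChartMaps fun W => SFun W × SFun W where
  res := Comp.res
  tr := Comp.tr n
  res_self := Comp.res_self
  res_res := Comp.res_res
  tr_tr := Comp.tr_tr n

/-- The components `c` over the parts of `V` in the charts are related by the transition map. -/
abbrev Comp.Compat (n : ℕ) {V : Opens (OnePoint ℂ)} (c : ∀ j, SFun (loc j V) × SFun (loc j V)) :
    Prop :=
  (Comp.chartMaps n).Compat c

lemma ov_mono (i : Fin 2) {V V' : Opens (OnePoint ℂ)} (h : V' ≤ V) : ov i V' ≤ ov i V :=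
  inf_le_inf_right _ (loc_mono i h)

lemma mem_loc_iSup {ι : Type} {V : ι → Opens (OnePoint ℂ)} {i : Fin 2} {x : ℂ}
    (hx : x ∈ loc i (⨆ j, V j)) : ∃ j, x ∈ loc i (V j) := by
  have h : pt i x ∈ ⨆ j, V j := hx
  obtain ⟨j, hj⟩ := Opens.mem_iSup.1 h
  exact ⟨j, hj⟩

lemma mem_ov_iSup {ι : Type} {V : ι → Opens (OnePoint ℂ)} {i : Fin 2} {x : ℂ}
    (hx : x ∈ ov i (⨆ j, V j)) : ∃ j, x ∈ ov i (V j) := by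
  obtain ⟨j, hj⟩ := mem_loc_iSup hx.1
  exact ⟨j, hj, hx.2⟩

namespace Comp

lemma res_ov_res (i : Fin 2) {V V' : Opens (OnePoint ℂ)} (h : V' ≤ V)
    (c : SFun (loc i V) × SFun (loc i V)) :
    res (ov_le i V') (res (loc_mono i h) c) = res (ov_mono i h) (res (ov_le i V) c) := by
  rw [res_res, res_res]

lemma Compat.res {n : ℕ} {V V' : Opens (OnePoint ℂ)} (h : V' ≤ V)
    {c : ∀ j, SFun (loc j V) × SFun (loc j V)} (hc : Compat n c) :
    Compat n fun j => Comp.res (loc_mono j h) (c j) := by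
  change tr n _ (Comp.res _ _) = Comp.res _ _
  have hc' : tr n (overlap V) (Comp.res (ov_le 0 V) (c 0)) = Comp.res (ov_le 1 V) (c 1) := hc
  rw [res_ov_res 0 h, res_ov_res 1 h, ← hc', tr_res n (overlap V)]

lemma Compat.d {n : ℕ} {V : Opens (OnePoint ℂ)} {c : ∀ j, SFun (loc j V) × SFun (loc j V)}
    (hc : Compat (n + 1) c) : Compat n fun j => Comp.d n (c j) := by
  change tr n _ (Comp.res _ _) = Comp.res _ _
  have hc' : tr (n + 1) (overlap V) (Comp.res (ov_le 0 V) (c 0)) = Comp.res (ov_le 1 V) (c 1) := hc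
  rw [← d_res, ← d_res, ← hc', d_tr]

lemma eq_of_res_eq {ι : Type} {U : Opens ℂ} {V : ι → Opens ℂ} (hV : ∀ j, V j ≤ U)
    (hU : ∀ x ∈ U, ∃ j, x ∈ V j) {c c' : SFun U × SFun U}
    (h : ∀ j, Comp.res (hV j) c = Comp.res (hV j) c') : c = c' :=
  Prod.ext (SFun.eq_of_res_eq hV hU fun j => congrArg Prod.fst (h j))
    (SFun.eq_of_res_eq hV hU fun j => congrArg Prod.snd (h j))

lemma exists_glue {n : ℕ} {ι : Type} {V : ι → Opens (OnePoint ℂ)}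
    {c : ∀ j i, SFun (loc i (V j)) × SFun (loc i (V j))} (hc : ∀ j, Compat n (c j))
    (h : ∀ j l i, Comp.res (loc_mono i inf_le_left : loc i (V j ⊓ V l) ≤ loc i (V j)) (c j i) =
      Comp.res (loc_mono i inf_le_right : loc i (V j ⊓ V l) ≤ loc i (V l)) (c l i)) :
    ∃ t : ∀ i, SFun (loc i (⨆ j, V j)) × SFun (loc i (⨆ j, V j)), Compat n t ∧
      ∀ j i, Comp.res (loc_mono i (le_iSup V j)) (t i) = c j i := by
  have key : ∀ i : Fin 2, ∃ t : SFun (loc i (⨆ j, V j)) × SFun (loc i (⨆ j, V j)),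
      ∀ j, Comp.res (loc_mono i (le_iSup V j)) t = c j i := by
    intro i
    obtain ⟨f, hf⟩ := SFun.exists_glue (fun j => loc_mono i (le_iSup V j))
      (fun x hx => mem_loc_iSup hx) (fun j => (c j i).1) fun j l => congrArg Prod.fst (h j l i)
    obtain ⟨g, hg⟩ := SFun.exists_glue (fun j => loc_mono i (le_iSup V j))
      (fun x hx => mem_loc_iSup hx) (fun j => (c j i).2) fun j l => congrArg Prod.snd (h j l i)
    exact ⟨(f, g), fun j => Prod.ext (hf j) (hg j)⟩
  choose t ht using key
  refine ⟨t, ?_, fun j i => ht i j⟩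
  change tr n _ (Comp.res _ _) = Comp.res _ _
  -- The glued pairs are compatible because equality over the overlap can be tested on the members
  -- of the cover, where it holds by assumption.
  refine eq_of_res_eq (fun j => ov_mono 1 (le_iSup V j)) (fun x hx => mem_ov_iSup hx) fun j => ?_
  have hcj : tr n (overlap (V j)) (Comp.res (ov_le 0 (V j)) (c j 0)) =
    Comp.res (ov_le 1 (V j)) (c j 1) := hc j
  rw [← tr_res n (overlap _) (overlap (V j)) (ov_mono 0 (le_iSup V j)),
    ← res_ov_res 0 (le_iSup V j), ← res_ov_res 1 (le_iSup V j), ht, ht, hcj]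

end Comp

/-! ### Sheaves with a frame in the charts -/

/-- A sheaf `S` glued from sections of `F` that, in the charts, are given by their components, with
the transition map `Comp.tr n`; the second component is absent for `n = 0`. The predicate `Mem`
singles out the sections in the charts. -/
structure Frame (F : ChartSheaf) (S : ∀ V, Submodule (O V) (Pairs F V)) (n : ℕ) where
  Mem : ∀ {W : Opens ℂ}, F.obj W → Prop
  comps : ∀ W : Opens ℂ, F.obj W →ₗ[SFun W] SFun W × SFun W
  ofComps : ∀ W : Opens ℂ, SFun W × SFun W →ₗ[SFun W] F.obj W
  mem_iff : ∀ {V : Opens (OnePoint ℂ)} {s : Pairs F V}, s ∈ S V ↔ s ∈ Glue F V ∧ ∀ i, Mem (s i)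
  mem_ofComps : ∀ {W : Opens ℂ} (c : SFun W × SFun W), Mem (ofComps W c)
  snd_comps : n = 0 → ∀ {W : Opens ℂ} {x : F.obj W}, Mem x → (comps W x).2 = 0
  ofComps_comps : ∀ {W : Opens ℂ} {x : F.obj W}, Mem x → ofComps W (comps W x) = x
  comps_ofComps : ∀ {W : Opens ℂ} {c : SFun W × SFun W}, (n = 0 → c.2 = 0) →
    comps W (ofComps W c) = c
  comps_res : ∀ {W W' : Opens ℂ} (h : W' ≤ W) (x : F.obj W),
    comps W' (F.res h x) = Comp.res h (comps W x)
  comps_tr : ∀ {W W' : Opens ℂ} (h : Overlap W W') {x : F.obj W}, Mem x →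
    comps W' (F.tr h x) = Comp.tr n h (comps W x)
  mem_res : ∀ {W W' : Opens ℂ} (h : W' ≤ W) {x : F.obj W}, Mem x → Mem (F.res h x)
  mem_tr : ∀ {W W' : Opens ℂ} (h : Overlap W W') {x : F.obj W}, Mem x → Mem (F.tr h x)

namespace Frame

variable {F : ChartSheaf} {S : ∀ V, Submodule (O V) (Pairs F V)} {n : ℕ}
  {V V' : Opens (OnePoint ℂ)}

section Components

variable (A : Frame F S n)

lemma eq_of_comps_eq {W : Opens ℂ} {x y : F.obj W} (hx : A.Mem x) (hy : A.Mem y)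
    (h : A.comps W x = A.comps W y) : x = y := by
  rw [← A.ofComps_comps hx, ← A.ofComps_comps hy, h]

/-- Taking components is injective on admissible sections and intertwines restriction and transition
maps, so gluing sections is the same as gluing their components. -/
lemma mem_iff_compat {s : Pairs F V} :
    s ∈ S V ↔ (∀ i, A.Mem (s i)) ∧ Comp.Compat n fun i => A.comps _ (s i) := by
  rw [A.mem_iff, and_comm]
  refine and_congr_right fun h => ?_
  change F.tr (overlap V) (F.res (ov_le 0 V) (s 0)) = F.res (ov_le 1 V) (s 1) ↔
    Comp.tr n (overlap V) (Comp.res (ov_le 0 V) _) = Comp.res (ov_le 1 V) _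
  rw [← A.comps_res, ← A.comps_res, ← A.comps_tr _ (A.mem_res _ (h 0))]
  exact ⟨fun h' => by rw [h'],
    fun h' => A.eq_of_comps_eq (A.mem_tr _ (A.mem_res _ (h 0))) (A.mem_res _ (h 1)) h'⟩

lemma mem (s : S V) (i : Fin 2) : A.Mem (s.1 i) := (A.mem_iff_compat.1 s.2).1 i

lemma compat (s : S V) : Comp.Compat n fun i => A.comps _ (s.1 i) := (A.mem_iff_compat.1 s.2).2

lemma ofComps_mem {c : ∀ i, SFun (loc i V) × SFun (loc i V)} (hc : Comp.Compat n c)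
    (h0 : n = 0 → ∀ i, (c i).2 = 0) : (fun i => A.ofComps _ (c i) : Pairs F V) ∈ S V := by
  refine A.mem_iff_compat.2 ⟨fun i => A.mem_ofComps _, ?_⟩
  have h : (fun i => A.comps _ (A.ofComps _ (c i))) = c :=
    funext fun i => A.comps_ofComps fun hn => h0 hn i
  rwa [h]

lemma comps_isRes (h : V' ≤ V) {s : Pairs F V} {t : Pairs F V'} (hst : IsRes h s t) (i : Fin 2) :
    A.comps _ (t i) = Comp.res (loc_mono i h) (A.comps _ (s i)) := by
  rw [← hst i, A.comps_res]

lemma isRes_of_comps (h : V' ≤ V) (s : S V) (t : S V')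
    (hst : ∀ i, A.comps _ (t.1 i) = Comp.res (loc_mono i h) (A.comps _ (s.1 i))) :
    IsRes h s.1 t.1 := fun i =>
  A.eq_of_comps_eq (A.mem_res _ (A.mem s i)) (A.mem t i) (by rw [A.comps_res, hst])

lemma isSheaf (A : Frame F S n) : IsSheaf S := by
  refine ⟨fun V V' h s hs => ⟨fun i => F.res (loc_mono i h) (s i), ?_, fun i => rfl⟩,
    fun ι V s hs hc => ?_⟩
  · obtain ⟨h1, h2⟩ := A.mem_iff_compat.1 hs
    refine A.mem_iff_compat.2 ⟨fun i => A.mem_res _ (h1 i), ?_⟩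
    simp only [A.comps_res]
    exact h2.res h
  · obtain ⟨c, hcc, hcr⟩ := Comp.exists_glue (n := n) (c := fun j i => A.comps _ (s j i))
      (fun j => (A.mem_iff_compat.1 (hs j)).2) fun j l i => by
        have h1 := congrFun (hc j l _ _ (fun i => rfl) fun i => rfl) i
        rw [← A.comps_res, ← A.comps_res, h1]
    -- Absence of the odd generator is a local condition, so it passes from the members of the cover
    -- to the glued components.
    have hc0 : n = 0 → ∀ i, (c i).2 = 0 := by
      intro hn i
      refine SFun.eq_of_res_eq (fun j => loc_mono i (le_iSup V j))
        (fun x hx => mem_loc_iSup hx) fun j => ?_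
      have h1 := congrArg Prod.snd (hcr j i)
      rw [A.snd_comps hn ((A.mem_iff_compat.1 (hs j)).1 i)] at h1
      rw [map_zero]
      exact h1
    refine ⟨fun i => A.ofComps _ (c i), ⟨A.ofComps_mem hcc hc0, fun j => ?_⟩, fun t ht => ?_⟩
    · refine A.isRes_of_comps _ ⟨_, A.ofComps_mem hcc hc0⟩ ⟨s j, hs j⟩ fun i => ?_
      rw [A.comps_ofComps fun hn => hc0 hn i, hcr]
    · funext i
      refine A.eq_of_comps_eq (A.mem ⟨t, ht.1⟩ i) (A.mem_ofComps _) ?_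
      rw [A.comps_ofComps fun hn => hc0 hn i]
      refine Comp.eq_of_res_eq (fun j => loc_mono i (le_iSup V j))
        (fun x hx => mem_loc_iSup hx) fun j => ?_
      rw [hcr, ← A.comps_isRes _ (ht.2 j)]

lemma eq_of_comps {s t : S V} (h : ∀ i, A.comps _ (s.1 i) = A.comps _ (t.1 i)) : s = t :=
  Subtype.ext (funext fun i => A.eq_of_comps_eq (A.mem s i) (A.mem t i) (h i))

/-- Sheaves with the same transition maps are isomorphic. -/
def equiv {F' : ChartSheaf} {S' : ∀ V, Submodule (O V) (Pairs F' V)} (B : Frame F' S' n)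
    (V : Opens (OnePoint ℂ)) : S V ≃ₗ[O V] S' V where
  toFun s := ⟨fun i => B.ofComps _ (A.comps _ (s.1 i)),
    B.ofComps_mem (A.compat s) fun hn i => A.snd_comps hn (A.mem s i)⟩
  map_add' s t := Subtype.ext <| funext fun i => by
    change B.ofComps _ (A.comps _ (s.1 i + t.1 i)) = B.ofComps _ _ + B.ofComps _ _
    rw [map_add, map_add]
  map_smul' a s := Subtype.ext <| funext fun i => by
    change B.ofComps _ (A.comps _ (a.1 i • s.1 i)) = a.1 i • B.ofComps _ _
    rw [map_smul, map_smul]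
  invFun s := ⟨fun i => A.ofComps _ (B.comps _ (s.1 i)),
    A.ofComps_mem (B.compat s) fun hn i => B.snd_comps hn (B.mem s i)⟩
  left_inv s := A.eq_of_comps fun i => by
    change A.comps _ (A.ofComps _ (B.comps _ (B.ofComps _ (A.comps _ (s.1 i))))) = _
    rw [B.comps_ofComps fun hn => A.snd_comps hn (A.mem s i),
      A.comps_ofComps fun hn => A.snd_comps hn (A.mem s i)]
  right_inv s := B.eq_of_comps fun i => by
    change B.comps _ (B.ofComps _ (A.comps _ (A.ofComps _ (B.comps _ (s.1 i))))) = _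
    rw [A.comps_ofComps fun hn => B.snd_comps hn (B.mem s i),
      B.comps_ofComps fun hn => B.snd_comps hn (B.mem s i)]

lemma equiv_symm_apply {F' : ChartSheaf} {S' : ∀ V, Submodule (O V) (Pairs F' V)}
    (B : Frame F' S' n) (s : S' V) (i : Fin 2) :
    ((A.equiv B V).symm s).1 i = A.ofComps _ (B.comps _ (s.1 i)) := rfl

lemma comps_equiv {F' : ChartSheaf} {S' : ∀ V, Submodule (O V) (Pairs F' V)} (B : Frame F' S' n)
    (s : S V) (i : Fin 2) : B.comps _ ((A.equiv B V s).1 i) = A.comps _ (s.1 i) :=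
  B.comps_ofComps fun hn => A.snd_comps hn (A.mem s i)

lemma equiv_isRes {F' : ChartSheaf} {S' : ∀ V, Submodule (O V) (Pairs F' V)} (B : Frame F' S' n)
    (h : V' ≤ V) (s : S V) (t : S V') (hst : IsRes h s.1 t.1) :
    IsRes h (A.equiv B V s).1 (A.equiv B V' t).1 :=
  B.isRes_of_comps h _ _ fun i => by rw [comps_equiv, comps_equiv, A.comps_isRes h hst]

end Components

/-- The differential of a sheaf with a frame. -/
def d {F' : ChartSheaf} {S' : ∀ V, Submodule (O V) (Pairs F' V)} (A : Frame F S (n + 1))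
    (B : Frame F' S' n) (V : Opens (OnePoint ℂ)) : S V →+ S' V where
  toFun s := ⟨fun i => B.ofComps _ (Comp.d n (A.comps _ (s.1 i))),
    B.ofComps_mem (A.compat s).d fun hn i => by subst hn; exact Comp.d_zero_snd _⟩
  map_zero' := B.eq_of_comps fun i => by
    have h : Comp.d n (A.comps _ ((0 : S V).1 i)) = 0 := by
      change Comp.d n (A.comps (loc i V) 0) = 0
      rw [map_zero]
      have := Comp.d_add n (0 : SFun (loc i V) × SFun (loc i V)) 0
      simpa using this
    change B.comps _ (B.ofComps _ (Comp.d n _)) = B.comps (loc i V) 0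
    rw [h, map_zero]
  map_add' s t := Subtype.ext <| funext fun i => by
    change B.ofComps _ (Comp.d n (A.comps _ (s.1 i + t.1 i))) = B.ofComps _ _ + B.ofComps _ _
    rw [map_add, Comp.d_add, map_add]

section Differential

variable {F' : ChartSheaf} {S' : ∀ V, Submodule (O V) (Pairs F' V)} (A : Frame F S (n + 1))
    (B : Frame F' S' n)

lemma d_apply (s : S V) (i : Fin 2) :
    (d A B V s).1 i = B.ofComps _ (Comp.d n (A.comps _ (s.1 i))) := rfl

lemma comps_d (s : S V) (i : Fin 2) :
    B.comps _ ((d A B V s).1 i) = Comp.d n (A.comps _ (s.1 i)) :=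
  B.comps_ofComps fun hn => by subst hn; exact Comp.d_zero_snd _

lemma d_isRes (h : V' ≤ V) (s : S V) (t : S V') (hst : IsRes h s.1 t.1) :
    IsRes h (d A B V s).1 (d A B V' t).1 :=
  B.isRes_of_comps h _ _ fun i => by rw [comps_d, comps_d, A.comps_isRes h hst, Comp.d_res]

lemma d_smul (c : ℂ) (s : S V) :
    d A B V (algebraMap ℂ (O V) c • s) = algebraMap ℂ (O V) c • d A B V s :=
  Subtype.ext <| funext fun i => by
    change B.ofComps _ (Comp.d n (A.comps _ (algebraMap ℂ (SFun (loc i V)) c • s.1 i))) =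
      algebraMap ℂ (SFun (loc i V)) c • B.ofComps _ _
    rw [map_smul, Comp.d_smul, map_smul]

end Differential

lemma d_d {F' F'' : ChartSheaf} {S' : ∀ V, Submodule (O V) (Pairs F' V)}
    {S'' : ∀ V, Submodule (O V) (Pairs F'' V)} (A : Frame F S (n + 2)) (B : Frame F' S' (n + 1))
    (C : Frame F'' S'' n) (s : S V) : d B C V (d A B V s) = 0 :=
  C.eq_of_comps fun i => by
    rw [comps_d, comps_d, Comp.d_d]
    exact (map_zero (C.comps (loc i V))).symm

/-- Over an open set inside the chart i, sections of O and of S are determined by their expressions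
in that chart. Being a basis can therefore be checked on components there. -/
lemma exists_basis (A : Frame F S n) {ι : Type} [Fintype ι] {i : Fin 2}
    (hV : (V : Set (OnePoint ℂ)) ⊆ Set.range (pt i)) (x : ι → S V)
    (hli : ∀ a : ι → SFun (loc i V), ∑ k, a k • A.comps _ ((x k).1 i) = 0 → a = 0)
    (hsp : ∀ s : S V, ∃ a : ι → SFun (loc i V),
      A.comps _ (s.1 i) = ∑ k, a k • A.comps _ ((x k).1 i)) :
    ∃ b : Module.Basis ι (O V) (S V), ∀ k, b k = x k := by
  have hsum : ∀ a : ι → O V, A.comps _ ((∑ k, a k • x k : S V).1 i) =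
      ∑ k, (a k).1 i • A.comps _ ((x k).1 i) := by
    intro a
    rw [Submodule.coe_sum, Finset.sum_apply, map_sum]
    refine Finset.sum_congr rfl fun k _ => ?_
    exact map_smul (A.comps _) ((a k).1 i) ((x k).1 i)
  have h1 : LinearIndependent (O V) x := by
    refine Fintype.linearIndependent_iffₛ.2 fun a b hab k => ?_
    have h2 := hsum a
    rw [hab, hsum] at h2
    have h3 := hli (fun k => (a k).1 i - (b k).1 i) (by
      simp only [sub_smul, Finset.sum_sub_distrib, h2, sub_self])
    -- Coefficients that agree in the chart i also agree in the other chart.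
    exact Subtype.ext (ChartMaps.Compat.ext (M := SFun.chartMaps) hV (a k).2 (b k).2
      (sub_eq_zero.1 (congrFun h3 k)))
  refine ⟨Module.Basis.mk h1 fun s _ => ?_, fun k => Module.Basis.mk_apply _ _ _⟩
  obtain ⟨a, ha⟩ := hsp s
  -- The coefficients found in the chart i are extended to sections of O over V; no further property
  -- has to be tracked.
  choose c hc hci _ using fun k => SFun.chartMaps.exists_compat hV (fun _ => True)
    (fun _ _ _ => trivial) (fun _ _ _ => trivial) (a k) trivial
  have hs : s = ∑ k, (⟨c k, hc k⟩ : O V) • x k := by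
    have h2 : (fun j => A.comps _ (s.1 j)) =
        fun j => A.comps _ ((∑ k, (⟨c k, hc k⟩ : O V) • x k : S V).1 j) := by
      refine ChartMaps.Compat.ext (M := Comp.chartMaps n) hV (A.compat s) (A.compat _) ?_
      rw [hsum, ha]
      exact Finset.sum_congr rfl fun k _ => by rw [← hci k]
    exact A.eq_of_comps fun j => congrFun h2 j
  rw [hs]
  exact Submodule.sum_mem _ fun k _ => Submodule.smul_mem _ _ (Submodule.subset_span ⟨k, rfl⟩)

/-- Produces the basis sections: components prescribed in one chart extend to the other, and parity
is kept in both. -/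
lemma exists_section (A : Frame F S n) {i : Fin 2} (hV : (V : Set (OnePoint ℂ)) ⊆ Set.range (pt i))
    (p : ZMod 2) (c : SFun (loc i V) × SFun (loc i V)) (h₁ : c.1.HasParity p)
    (h₂ : c.2.HasParity (p + 1)) (h0 : n = 0 → c.2 = 0) :
    ∃ s : S V, s.1 i = A.ofComps _ c ∧ ∀ j, ∃ c' : SFun (loc j V) × SFun (loc j V),
      s.1 j = A.ofComps _ c' ∧ c'.1.HasParity p ∧ c'.2.HasParity (p + 1) := by
  obtain ⟨t, ht, hti, htQ⟩ := (Comp.chartMaps n).exists_compat hV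
    (fun c => (c.1.HasParity p ∧ c.2.HasParity (p + 1)) ∧ (n = 0 → c.2 = 0))
    (fun h a ha => ⟨Comp.hasParity_res h ha.1.1 ha.1.2, fun hn => by
      change SFun.res h a.2 = 0
      rw [ha.2 hn, map_zero]⟩)
    (fun h a ha => ⟨Comp.hasParity_tr n h ha.1.1 ha.1.2, fun hn =>
      Comp.tr_snd_eq_zero n h (ha.2 hn)⟩) c ⟨⟨h₁, h₂⟩, h0⟩
  refine ⟨⟨_, A.ofComps_mem ht fun hn j => (htQ j).2 hn⟩, ?_, fun j => ⟨t j, rfl, (htQ j).1⟩⟩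
  rw [← hti]

end Frame

/-! ### Frames of the integral forms, of Ber ⊗ Sym^n ΠT and of Ber -/

/-- The frame `dz δ^{(n)}(dθ) | δ^{(n-1)}(dθ)` of the integral forms of degree `1 - n`. -/
def Delta.frame (n : ℕ) : Frame DeltaForms (DeltaSheaf (1 - (n : ℤ))) n where
  Mem := Delta.HasDegree (1 - (n : ℤ))
  comps := Delta.comps n
  ofComps := Delta.ofComps n
  mem_iff := Iff.rfl
  mem_ofComps := Delta.hasDegree_ofComps n
  snd_comps := by
    rintro rfl W x hx
    exact Delta.comps_snd_eq_zero hx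
  ofComps_comps := Delta.ofComps_comps
  comps_ofComps := Delta.comps_ofComps
  comps_res := Delta.comps_res n
  comps_tr := Delta.comps_tr n
  mem_res := Delta.hasDegree_res
  mem_tr := Delta.hasDegree_tr n

/-- The frame `𝒟 ⊗ (π∂_θ)^n | 𝒟 ⊗ π∂_z (π∂_θ)^{n-1}` of `Ber ⊗ Sym^n ΠT`. -/
def BerSym.frame (n : ℕ) : Frame (BerSym n) (BerSymSheaf n) n where
  Mem := fun _ => True
  comps := BerSym.comps n
  ofComps := BerSym.ofComps n
  mem_iff := by simp
  mem_ofComps := fun _ => trivial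
  snd_comps := by
    rintro rfl W x -
    obtain ⟨F, G, rfl⟩ := BerSym.exists_berSym x
    rw [BerSym.comps_berSym_zero]
  ofComps_comps := fun _ => BerSym.berSym_comps _
  comps_ofComps := by
    intro W c hc
    rcases n with _ | n
    · exact (BerSym.comps_berSym_zero _ _).trans (Prod.ext rfl (hc rfl).symm)
    · exact BerSym.comps_berSym_succ _ _ _
  comps_res := BerSym.comps_res n
  comps_tr := fun h _ _ => BerSym.comps_tr n h _
  mem_res := fun _ _ _ => trivial
  mem_tr := fun _ _ _ => trivial

/-- For n = 0 the transition map reduces to the one of Ber, which makes Ber an instance of `Frame`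
and yields Ber ⊗ Sym^0 ΠT ≅ Ber. -/
lemma Comp.tr_zero_fst {W W' : Opens ℂ} (h : Overlap W W') (f : SFun W) :
    (Comp.tr 0 h (f, 0)).1 = -(SFun.invZ h.ne' * trans h f) := by
  rw [Comp.tr, map_zero]
  ring

/-- The frame `𝒟` of `Ber`. -/
def Ber.frame : Frame Ber (Glue Ber) 0 where
  Mem := fun _ => True
  comps W := LinearMap.inl (SFun W) (SFun W) (SFun W)
  ofComps W := LinearMap.fst (SFun W) (SFun W) (SFun W)
  mem_iff := by simp
  mem_ofComps := fun _ => trivial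
  snd_comps := fun _ _ _ _ => rfl
  ofComps_comps := fun _ => rfl
  comps_ofComps := fun hc => Prod.ext rfl (hc rfl).symm
  comps_res := fun h _ => Prod.ext rfl (map_zero (SFun.res h)).symm
  comps_tr := fun h x _ => by
    refine Prod.ext ?_ (Comp.tr_snd_eq_zero 0 h rfl).symm
    exact (Ber_tr_apply h x).trans (Comp.tr_zero_fst h x).symm
  mem_res := fun _ _ _ => trivial
  mem_tr := fun _ _ _ => trivial

/-! ### Transition matrices, differential and bases on explicit generators -/

lemma Delta.frame_ofComps_succ (n : ℕ) {W : Opens ℂ} (c : SFun W × SFun W) :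
    (Delta.frame (n + 1)).ofComps W c = (c.1 • sym W 1 (n + 1) + c.2 • sym W 0 n : Delta W) := rfl

lemma Delta.tr_sym_one {W W' : Opens ℂ} (h : Overlap W W') (n : ℕ) :
    DeltaForms.tr h (sym W 1 n) = (-(SFun.z W' ^ n * SFun.invZ h.ne')) • sym W' 1 n := by
  have h1 := Delta.tr_smul_sym h 1 1 n
  rw [map_one, one_smul, one_smul, symTrans_one] at h1
  exact h1

lemma Delta.tr_sym_zero {W W' : Opens ℂ} (h : Overlap W W') (n : ℕ) :
    DeltaForms.tr h (sym W 0 n) = (SFun.θ W' * SFun.z W' ^ n) • sym W' 1 (n + 1) +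
      SFun.z W' ^ (n + 1) • sym W' 0 n := by
  have h1 := Delta.tr_smul_sym h 1 0 n
  rw [map_one, one_smul, one_smul, symTrans_zero, add_comm] at h1
  exact h1

lemma BerSym.tr_even {W W' : Opens ℂ} (h : Overlap W W') (n : ℕ) :
    (BerSym n).tr h (berSym n 1 0) = berSym n (-(SFun.z W' ^ n * SFun.invZ h.ne')) 0 := by
  rw [tr_berSym _ _ _ _ fun _ => rfl, Comp.tr]
  simp only [map_one, map_zero, mul_zero, mul_one, add_zero]

lemma BerSym.tr_odd {W W' : Opens ℂ} (h : Overlap W W') (n : ℕ) :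
    (BerSym (n + 1)).tr h (berSym (n + 1) 0 1) =
      berSym (n + 1) (SFun.θ W' * SFun.z W' ^ n) (SFun.z W' ^ (n + 1)) := by
  rw [tr_berSym _ _ _ _ fun h => absurd h (Nat.add_one_ne_zero n), Comp.tr]
  simp only [map_one, map_zero, mul_zero, mul_one, zero_add]
  congr 1
  linear_combination SFun.θ W' * SFun.z W' ^ n * SFun.z_mul_invZ h.ne'

lemma BerSym.d_apply {n : ℕ} {V : Opens (OnePoint ℂ)} (s : BerSymSheaf (n + 1) V) {i : Fin 2}
    {F G : SFun (loc i V)} (h : s.1 i = berSym (n + 1) F G) :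
    ((frame (n + 1)).d (frame n) V s).1 i =
      berSym n (-((n : SFun (loc i V)) + 1) * F.dθ + G.dz.inv) (-(n : SFun (loc i V)) * G.dθ) := by
  have h1 : (frame (n + 1)).comps (loc i V) (s.1 i) = (F, G) := by
    rw [h]
    exact comps_berSym_succ n F G
  rw [Frame.d_apply, h1]
  exact ofComps_apply n _

lemma Delta.exists_basis_succ (n : ℕ) {i : Fin 2} {V : Opens (OnePoint ℂ)}
    (hV : (V : Set (OnePoint ℂ)) ⊆ Set.range (pt i)) :
    ∃ b : Module.Basis (Fin 2) (O V) (DeltaSheaf (1 - ((n + 1 : ℕ) : ℤ)) V),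
      (b 0).1 i = sym (loc i V) 1 (n + 1) ∧ (b 1).1 i = sym (loc i V) 0 n ∧
      ∀ j, HasParity 0 ((b 0).1 j) ∧ HasParity 1 ((b 1).1 j) := by
  obtain ⟨s, hs, hsp⟩ := (frame (n + 1)).exists_section hV 0 (1, 0) SFun.hasParity_one
    (SFun.hasParity_zero _) fun h => absurd h n.succ_ne_zero
  obtain ⟨t, ht, htp⟩ := (frame (n + 1)).exists_section hV 1 (0, 1) (SFun.hasParity_zero _)
    SFun.hasParity_one fun h => absurd h n.succ_ne_zero
  have hs' : (frame (n + 1)).comps _ (s.1 i) = (1, 0) := by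
    rw [hs, (frame (n + 1)).comps_ofComps fun h => absurd h n.succ_ne_zero]
  have ht' : (frame (n + 1)).comps _ (t.1 i) = (0, 1) := by
    rw [ht, (frame (n + 1)).comps_ofComps fun h => absurd h n.succ_ne_zero]
  obtain ⟨b, hb⟩ := (frame (n + 1)).exists_basis hV ![s, t] (fun a ha => by
    simp only [Fin.sum_univ_two, Matrix.cons_val_zero, Matrix.cons_val_one, hs', ht'] at ha
    funext k
    fin_cases k
    · simpa using congrArg Prod.fst ha
    · simpa using congrArg Prod.snd ha) fun r =>
      ⟨![((frame (n + 1)).comps _ (r.1 i)).1, ((frame (n + 1)).comps _ (r.1 i)).2], by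
        simp only [Fin.sum_univ_two, Matrix.cons_val_zero, Matrix.cons_val_one, hs', ht']
        refine Prod.ext ?_ ?_ <;> simp⟩
  have hb0 : b 0 = s := hb 0
  have hb1 : b 1 = t := hb 1
  refine ⟨b, ?_, ?_, fun j => ⟨?_, ?_⟩⟩
  · rw [hb0, hs, frame_ofComps_succ, one_smul, zero_smul, add_zero]
  · rw [hb1, ht, frame_ofComps_succ, one_smul, zero_smul, zero_add]
  · obtain ⟨c, hc, h1, h2⟩ := hsp j
    rw [hb0, hc]
    exact hasParity_ofComps _ h1 h2
  · obtain ⟨c, hc, h1, h2⟩ := htp j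
    rw [hb1, hc]
    exact hasParity_ofComps _ h1 h2

lemma Delta.exists_basis_zero {i : Fin 2} {V : Opens (OnePoint ℂ)}
    (hV : (V : Set (OnePoint ℂ)) ⊆ Set.range (pt i)) :
    ∃ b : Module.Basis (Fin 1) (O V) (DeltaSheaf (1 - ((0 : ℕ) : ℤ)) V),
      (b 0).1 i = sym (loc i V) 1 0 ∧ ∀ j, HasParity 0 ((b 0).1 j) := by
  obtain ⟨s, hs, hsp⟩ := (frame 0).exists_section hV 0 (1, 0) SFun.hasParity_one
    (SFun.hasParity_zero _) fun _ => rfl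
  have hs' : (frame 0).comps _ (s.1 i) = (1, 0) := by
    rw [hs, (frame 0).comps_ofComps fun _ => rfl]
  obtain ⟨b, hb⟩ := (frame 0).exists_basis hV ![s] (fun a ha => by
    simp only [Fin.sum_univ_one, Matrix.cons_val_zero, hs'] at ha
    funext k
    fin_cases k
    simpa using congrArg Prod.fst ha) fun r =>
      ⟨![((frame 0).comps _ (r.1 i)).1], by
        simp only [Fin.sum_univ_one, Matrix.cons_val_zero, hs']
        refine Prod.ext ?_ ?_
        · simp
        -- A form of degree 1 has no second component, so a single generator suffices.
        · rw [(frame 0).snd_comps rfl ((frame 0).mem r i)]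
          simp⟩
  have hb0 : b 0 = s := hb 0
  refine ⟨b, ?_, fun j => ?_⟩
  · rw [hb0, hs]
    exact one_smul (SFun (loc i V)) (sym (loc i V) 1 0)
  · obtain ⟨c, hc, h1, h2⟩ := hsp j
    rw [hb0, hc]
    exact hasParity_ofComps _ h1 h2

end SuperP1

end

open SuperP1 in
theorem mainTheorem1 :
    -- the transition matrices on the overlap of the charts, in the two formalisms
    (∀ {W W' : TopologicalSpace.Opens ℂ} (h : Overlap W W') (n : ℕ),
      DeltaForms.tr h (Delta.sym W 1 n) =
        (-(SFun.z W' ^ n * SFun.invZ h.ne')) • Delta.sym W' 1 n ∧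
      DeltaForms.tr h (Delta.sym W 0 n) =
        (SFun.θ W' * SFun.z W' ^ n) • Delta.sym W' 1 (n + 1) +
          SFun.z W' ^ (n + 1) • Delta.sym W' 0 n ∧
      (BerSym n).tr h (berSym n 1 0) = berSym n (-(SFun.z W' ^ n * SFun.invZ h.ne')) 0 ∧
      (BerSym (n + 1)).tr h (berSym (n + 1) 0 1) =
        berSym (n + 1) (SFun.θ W' * SFun.z W' ^ n) (SFun.z W' ^ (n + 1))) ∧
    -- integral forms of degree `k = 1 - n ≤ 1` and `Ber ⊗ Sym^n ΠT` are sheaves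
    (∀ n : ℕ, IsSheaf (DeltaSheaf (1 - (n : ℤ)))) ∧
    (∀ n : ℕ, IsSheaf (BerSymSheaf n)) ∧
    ∃ (Φ : ∀ (n : ℕ) (V : TopologicalSpace.Opens (OnePoint ℂ)),
          DeltaSheaf (1 - (n : ℤ)) V ≃ₗ[O V] BerSymSheaf n V)
      (d : ∀ (n : ℕ) (V : TopologicalSpace.Opens (OnePoint ℂ)),
          BerSymSheaf (n + 1) V →+ BerSymSheaf n V)
      (Ψ : ∀ V : TopologicalSpace.Opens (OnePoint ℂ), BerSymSheaf 0 V ≃ₗ[O V] Glue Ber V),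
      -- `Φ` is an isomorphism of sheaves of modules, even, and given in the charts by
      -- `dz δ^{(n)}(dθ) ↦ 𝒟 ⊗ (π∂_θ)^n`, `δ^{(n-1)}(dθ) ↦ 𝒟 ⊗ π∂_z (π∂_θ)^{n-1}`
      (∀ (n : ℕ) (V V' : TopologicalSpace.Opens (OnePoint ℂ)) (h : V' ≤ V)
        (s : DeltaSheaf (1 - (n : ℤ)) V) (t : DeltaSheaf (1 - (n : ℤ)) V'),
        IsRes h s.1 t.1 → IsRes h (Φ n V s).1 (Φ n V' t).1) ∧
      (∀ (n : ℕ) (V : TopologicalSpace.Opens (OnePoint ℂ)) (s : DeltaSheaf (1 - (n : ℤ)) V)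
        (i : Fin 2),
        (Φ n V s).1 i = berSym n (Delta.coeff (s.1 i) 1 n) (Delta.coeff (s.1 i) 0 (n - 1))) ∧
      (∀ (n : ℕ) (V : TopologicalSpace.Opens (OnePoint ℂ)) (s : DeltaSheaf (1 - (n : ℤ)) V)
        (p : ZMod 2), (∀ i, Delta.HasParity p (s.1 i)) →
          ∀ i, (Φ n V s).1 i ∈ BerSym.parity n (loc i V) p) ∧
      -- over the charts both sheaves are free, of rank `1|1` for `k < 1` and `1|0` for `k = 1`
      (∀ (n : ℕ) (i : Fin 2) (V : TopologicalSpace.Opens (OnePoint ℂ)),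
        (V : Set (OnePoint ℂ)) ⊆ Set.range (pt i) →
        ∃ b : Module.Basis (Fin 2) (O V) (DeltaSheaf (1 - ((n + 1 : ℕ) : ℤ)) V),
          (b 0).1 i = Delta.sym (loc i V) 1 (n + 1) ∧
          (b 1).1 i = Delta.sym (loc i V) 0 n ∧
          (∀ j, Delta.HasParity 0 ((b 0).1 j) ∧ Delta.HasParity 1 ((b 1).1 j)) ∧
          (Φ (n + 1) V (b 0)).1 i = berSym (n + 1) 1 0 ∧
          (Φ (n + 1) V (b 1)).1 i = berSym (n + 1) 0 1) ∧
      (∀ (i : Fin 2) (V : TopologicalSpace.Opens (OnePoint ℂ)),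
        (V : Set (OnePoint ℂ)) ⊆ Set.range (pt i) →
        ∃ b : Module.Basis (Fin 1) (O V) (DeltaSheaf (1 - ((0 : ℕ) : ℤ)) V),
          (b 0).1 i = Delta.sym (loc i V) 1 0 ∧
          (∀ j, Delta.HasParity 0 ((b 0).1 j)) ∧
          (Φ 0 V (b 0)).1 i = berSym 0 1 0) ∧
      -- the differential is a `ℂ`-linear morphism of sheaves, given in the charts by contracting
      -- the differentials of the coefficients with `ΠT`, and corresponds to `d` on the delta forms
      (∀ (n : ℕ) (V V' : TopologicalSpace.Opens (OnePoint ℂ)) (h : V' ≤ V)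
        (s : BerSymSheaf (n + 1) V) (t : BerSymSheaf (n + 1) V'),
        IsRes h s.1 t.1 → IsRes h (d n V s).1 (d n V' t).1) ∧
      (∀ (n : ℕ) (V : TopologicalSpace.Opens (OnePoint ℂ)) (c : ℂ) (s : BerSymSheaf (n + 1) V),
        d n V (algebraMap ℂ (O V) c • s) = algebraMap ℂ (O V) c • d n V s) ∧
      (∀ (n : ℕ) (V : TopologicalSpace.Opens (OnePoint ℂ)) (s : BerSymSheaf (n + 1) V) (i : Fin 2)
        (F G : SFun (loc i V)), s.1 i = berSym (n + 1) F G →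
        (d n V s).1 i = berSym n (-((n : SFun (loc i V)) + 1) * F.dθ + G.dz.inv)
          (-(n : SFun (loc i V)) * G.dθ)) ∧
      (∀ (n : ℕ) (V : TopologicalSpace.Opens (OnePoint ℂ))
        (s : DeltaSheaf (1 - ((n + 1 : ℕ) : ℤ)) V) (i : Fin 2),
        ((Φ n V).symm (d n V (Φ (n + 1) V s))).1 i = Delta.d (s.1 i)) ∧
      -- it squares to zero
      (∀ (n : ℕ) (V : TopologicalSpace.Opens (OnePoint ℂ)) (s : BerSymSheaf (n + 2) V),
        d n V (d (n + 1) V s) = 0) ∧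
      -- the last sheaf of the complex (`k = 1`) is the Berezinian sheaf
      (∀ (V V' : TopologicalSpace.Opens (OnePoint ℂ)) (h : V' ≤ V) (s : BerSymSheaf 0 V)
        (t : BerSymSheaf 0 V'), IsRes h s.1 t.1 → IsRes h (Ψ V s).1 (Ψ V' t).1) ∧
      (∀ (V : TopologicalSpace.Opens (OnePoint ℂ)) (s : BerSymSheaf 0 V) (i : Fin 2),
        s.1 i = berSym 0 ((Ψ V s).1 i) 0) := by
  have hΦ : ∀ (n : ℕ) (V : TopologicalSpace.Opens (OnePoint ℂ)) (s : DeltaSheaf (1 - (n : ℤ)) V)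
      (i : Fin 2), ((Delta.frame n).equiv (BerSym.frame n) V s).1 i =
        berSym n (Delta.coeff (s.1 i) 1 n) (Delta.coeff (s.1 i) 0 (n - 1)) :=
    fun _ _ _ _ => rfl
  refine ⟨fun h n => ⟨Delta.tr_sym_one h n, Delta.tr_sym_zero h n, BerSym.tr_even h n,
    BerSym.tr_odd h n⟩, fun n => (Delta.frame n).isSheaf, fun n => (BerSym.frame n).isSheaf,
    fun n => (Delta.frame n).equiv (BerSym.frame n),
    fun n => (BerSym.frame (n + 1)).d (BerSym.frame n), (BerSym.frame 0).equiv Ber.frame,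
    fun n V V' h s t => (Delta.frame n).equiv_isRes (BerSym.frame n) h s t, hΦ, ?_, ?_, ?_,
    ?_, ?_, ?_, ?_, ?_, fun V V' h s t => (BerSym.frame 0).equiv_isRes Ber.frame h s t, ?_⟩
  · intro n V s p hs i
    obtain ⟨h1, h2⟩ := (hs i).comps n
    exact BerSym.berSym_mem_parity n h1 h2
  · intro n i V hV
    obtain ⟨b, h0, h1, hp⟩ := Delta.exists_basis_succ n hV
    refine ⟨b, h0, h1, hp, ?_, ?_⟩
    · rw [hΦ, h0]
      congr 1 <;> simp [Delta.coeff, Delta.sym]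
    · rw [hΦ, h1]
      congr 1 <;> simp [Delta.coeff, Delta.sym]
  · intro i V hV
    obtain ⟨b, h0, hp⟩ := Delta.exists_basis_zero hV
    refine ⟨b, h0, hp, ?_⟩
    rw [hΦ, h0]
    congr 1 <;> simp [Delta.coeff, Delta.sym]
  · exact fun n V V' h s t => (BerSym.frame (n + 1)).d_isRes (BerSym.frame n) h s t
  · exact fun n V c s => (BerSym.frame (n + 1)).d_smul (BerSym.frame n) c s
  · intro n V s i F G h
    exact BerSym.d_apply s h
  · intro n V s i
    rw [Frame.equiv_symm_apply, Frame.comps_d, Frame.comps_equiv]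
    -- After the isomorphisms are unwound, the left side is `Delta.ofComps` of `Comp.d` of the
    -- components of the form, which is the delta-form differential of the form rebuilt from its
    -- components.
    refine (Delta.d_ofComps n _).symm.trans ?_
    exact congrArg Delta.d ((Delta.frame (n + 1)).ofComps_comps ((Delta.frame (n + 1)).mem s i))
  · exact fun n V s => (BerSym.frame (n + 2)).d_d (BerSym.frame (n + 1)) (BerSym.frame n) s
  · intro V s i
    refine ((BerSym.frame 0).ofComps_comps trivial).symm.trans ?_
    change berSym 0 _ _ = _
    -- The second argument multiplies the generator `symOdd` of degree 0, which is 0, so it may be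
    -- replaced by 0.
    rw [BerSym.berSym_zero_right]
    rfl
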